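/- Let $D$ be the open unit disc in $\mathbb R^2$ and, for $0\le r<1$, let $\Phi_r(\theta)=\dfrac{1-r^2}{2\pi(1-2r\cos\theta+r^2)}$. For a $2\pi$-periodic $g:\mathbb R\to\mathbb R$ let $P[g](re^{i\theta})=\int_{-\pi}^{\pi}g(\phi)\,\Phi_r(\phi-\theta)\,d\phi$ be its Poisson integral on $D$, and for $u:D\to\mathbb R$ write $u_r(\theta)=u(re^{i\theta})$. Let $Vg$ be the variation of $g$ over one period, $\mathcal{BV}$ the set of $2\pi$-periodic $g:\mathbb R\to\mathbb R$ with $Vg<\infty$, and $\mathcal{NBV}$ the space of $g\in\mathcal{BV}$ that are right continuous and satisfy $g(-\pi)=0$, with norm $Vg$. Let $\mathcal{HK}$ be the set of $2\pi$-periodic $f:\mathbb R\to\mathbb R$ that are Henstock--Kurzweil integrable over $[-\pi,\pi]$. Weak* convergence to $g\in\mathcal{NBV}$ is understood with respect to the pairing $\int_{-\pi}^{\pi}fg$, $f\in\mathcal{HK}$ (a Henstock--Kurzweil integral). Let $h^{\mathcal{BV}}$ be the space of harmonic $u:D\to\mathbb R$ with $\|u\|_{\mathcal{BV}}:=\sup_{0\le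 r<1}Vu_r<\infty$. Since $\|u\|_{\mathcal{BV}}=0$ exactly when $u$ is constant, functions in $h^{\mathcal{BV}}$ that differ by a constant are identified when $h^{\mathcal{BV}}$ is regarded as a normed space. **Theorem.** Let $g\in\mathcal{BV}$ and $v=P[g]$. (a) If $g\in\mathcal{NBV}$ then $v_r\to g$ weak* as $r\to1^-$: for every $f\in\mathcal{HK}$, the products $fg$ and $fv_r$ ($0\le r<1$) are Henstock--Kurzweil integrable over $[-\pi,\pi]$ and $\int_{-\pi}^{\pi}fv_r\to\int_{-\pi}^{\pi}fg$. (b) $\|v_r\|_\infty\le\inf|g|+Vg$ for all $0\le r<1$. (c) If $g\in\mathcal{NBV}$ then $\|v_r\|_\infty\le Vg$ for all $0\le r<1$. (d) $Vv_r\le Vg$ for all $0\le r<1$. (e) Convergence in variation can fail: there is $\sigma\in\mathcal{NBV}$ such that, with $w=P[\sigma]$, $V(w_r-\sigma)\not\to0$ as $r\to1^-$. Also, there is $\tau\in\mathcal{BV}$ with $\tau(\theta)=[\tau(\theta+)+\tau(\theta-)]/2$ for all $\theta$ such that, with $w=P[\tau]$, $V(w_r-\tau)\not\to0$ as $r\to1^-$.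 (f) The seminorm $\|\cdot\|_{\mathcal{BV}}$ on $h^{\mathcal{BV}}$ vanishes exactly on the constants. With functions that differ by a constant identified, $h^{\mathcal{BV}}$ is a Banach space; $\mathcal{NBV}$ is a Banach space; and $g\mapsto P[g]$ maps $\mathcal{NBV}$ into $h^{\mathcal{BV}}$ and induces a linear isometric isomorphism of $\mathcal{NBV}$ onto this Banach space. -/

import Mathlib

open Set Filter Topology MeasureTheory InnerProductSpace
open scoped ENNReal

noncomputable section

namespace PoissonBV

/-! ### The Poisson integral -/

/-- The open unit disc `D` of the complex plane, as a type. -/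
abbrev Disc : Type := Metric.ball (0 : ℂ) 1

/-- The Poisson kernel `Φ_r(θ) = (1 - r²) / (2π (1 - 2 r cos θ + r²))`. -/
def polarPoissonKernel (r θ : ℝ) : ℝ :=
  (1 - r ^ 2) / (2 * Real.pi * (1 - 2 * r * Real.cos θ + r ^ 2))

/-- The Poisson integral `P[g](r e^{iθ}) = ∫_{-π}^{π} g(φ) Φ_r(φ - θ) dφ`, for `g` integrable on a
period (in particular for `g` of bounded variation). Here `r = |z|` and `θ = arg z`; the kernel is
`2π`-periodic in `θ`, and does not depend on `θ` at the origin. -/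
def poissonIntegral (g : ℝ → ℝ) (z : Disc) : ℝ :=
  ∫ φ in (-Real.pi)..Real.pi, g φ * polarPoissonKernel ‖(z : ℂ)‖ (φ - Complex.arg (z : ℂ))

open Classical in
/-- The extension by zero of a function on the disc to the whole plane. -/
def extendZero (u : Disc → ℝ) (z : ℂ) : ℝ :=
  if h : z ∈ Metric.ball (0 : ℂ) 1 then u ⟨z, h⟩ else 0

/-- `u_r(θ) = u(r e^{iθ})`, meaningful for `0 ≤ r < 1`. -/
def slice (u : Disc → ℝ) (r θ : ℝ) : ℝ :=
  extendZero u (circleMap 0 r θ)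

/-- `u : D → ℝ` is harmonic in the (open) disc. -/
def IsHarmonicOnDisc (u : Disc → ℝ) : Prop :=
  HarmonicOnNhd (extendZero u) (Metric.ball (0 : ℂ) 1)

/-! ### Bounded variation -/

/-- The variation `V g` of `g` over one period, as an extended nonnegative real. -/
def variation (g : ℝ → ℝ) : ℝ≥0∞ :=
  eVariationOn g (Icc (-Real.pi) Real.pi)

/-- The class `BV` of `2π`-periodic functions with finite variation over one period. -/
def IsBV (g : ℝ → ℝ) : Prop :=
  Function.Periodic g (2 * Real.pi) ∧ variation g < ∞

lemma variation_zero : variation 0 = 0 :=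
  eVariationOn.constant_on (f := (0 : ℝ → ℝ)) (by
    rintro _ ⟨x, -, rfl⟩ _ ⟨y, -, rfl⟩
    rfl)

lemma variation_add_le (f g : ℝ → ℝ) : variation (f + g) ≤ variation f + variation g := by
  refine iSup_le fun p => ?_
  calc ∑ i ∈ Finset.range p.1, edist ((f + g) (p.2.1 (i + 1))) ((f + g) (p.2.1 i))
      ≤ ∑ i ∈ Finset.range p.1, (edist (f (p.2.1 (i + 1))) (f (p.2.1 i))
          + edist (g (p.2.1 (i + 1))) (g (p.2.1 i))) :=
        Finset.sum_le_sum fun i _ => edist_add_add_le _ _ _ _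
    _ ≤ variation f + variation g := by
        rw [Finset.sum_add_distrib]
        exact add_le_add (eVariationOn.sum_le p.2.2.1 p.2.2.2)
          (eVariationOn.sum_le p.2.2.1 p.2.2.2)

lemma variation_smul (c : ℝ) (f : ℝ → ℝ) : variation (c • f) = ‖c‖ₑ * variation f := by
  unfold variation eVariationOn
  rw [ENNReal.mul_iSup]
  refine iSup_congr fun p => ?_
  rw [Finset.mul_sum]
  refine Finset.sum_congr rfl fun i _ => ?_
  simp only [Pi.smul_apply, smul_eq_mul, edist_eq_enorm_sub, ← mul_sub, enorm_mul]

lemma variation_neg (f : ℝ → ℝ) : variation (-f) = variation f := by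
  have h := variation_smul (-1) f
  simpa using h

/-! ### The space `NBV` of functions of normalised bounded variation -/

/-- `NBV`, as a linear space of functions: `g` is `2π`-periodic, of finite variation over one
period, `g(-π) = 0`, and `g` is right continuous. -/
def nbv : Submodule ℝ (ℝ → ℝ) where
  carrier := {g | IsBV g ∧ g (-Real.pi) = 0 ∧ ∀ x, ContinuousWithinAt g (Ici x) x}
  zero_mem' := ⟨⟨fun _ => rfl, by rw [variation_zero]; exact ENNReal.zero_lt_top⟩, rfl,
    fun _ => continuousWithinAt_const⟩
  add_mem' := by
    rintro f g ⟨⟨hf, hfv⟩, hf0, hfc⟩ ⟨⟨hg, hgv⟩, hg0, hgc⟩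
    refine ⟨⟨hf.add hg, (variation_add_le f g).trans_lt (ENNReal.add_lt_top.2 ⟨hfv, hgv⟩)⟩, ?_,
      fun x => (hfc x).add (hgc x)⟩
    simp [hf0, hg0]
  smul_mem' := by
    rintro c f ⟨⟨hf, hfv⟩, hf0, hfc⟩
    refine ⟨⟨hf.smul c, ?_⟩, ?_, fun x => (hfc x).const_smul c⟩
    · rw [variation_smul]
      exact ENNReal.mul_lt_top enorm_lt_top hfv
    · simp [hf0]

/-- The space `NBV`. It is a separate type, so that its norm is the variation and its topology is
the one of this norm. -/
def NBV : Type := nbv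

instance : AddCommGroup NBV := inferInstanceAs (AddCommGroup nbv)

instance : Module ℝ NBV := inferInstanceAs (Module ℝ nbv)

/-- The function underlying an element of `NBV`. -/
def NBV.toFun (g : NBV) : ℝ → ℝ := Subtype.val (p := fun g => g ∈ nbv) g

/-- The variation `V g`, as a real number, is a norm on `NBV`. -/
def NBV.addGroupNorm : AddGroupNorm NBV where
  toFun g := (variation g.toFun).toReal
  map_zero' := by
    change (variation 0).toReal = 0
    simp [variation_zero]
  add_le' f g := by
    have hf : variation f.toFun < ∞ := f.2.1.2
    have hg : variation g.toFun < ∞ := g.2.1.2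
    rw [← ENNReal.toReal_add hf.ne hg.ne]
    exact ENNReal.toReal_mono (ENNReal.add_lt_top.2 ⟨hf, hg⟩).ne (variation_add_le _ _)
  neg' f := by
    change (variation (-f.toFun)).toReal = _
    rw [variation_neg]
  eq_zero_of_map_eq_zero' f h := by
    have hf : variation f.toFun < ∞ := f.2.1.2
    have h0 : variation f.toFun = 0 := (ENNReal.toReal_eq_zero_iff _).1 h |>.resolve_right hf.ne
    have hper : Function.Periodic f.toFun (2 * Real.pi) := f.2.1.1
    have hz : f.toFun (-Real.pi) = 0 := f.2.2.1
    refine Subtype.ext (funext fun x => ?_)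
    change f.toFun x = 0
    obtain ⟨y, hy, hxy⟩ := hper.exists_mem_Ico Real.two_pi_pos x (-Real.pi)
    have hy' : y ∈ Icc (-Real.pi) Real.pi := ⟨hy.1, by linarith [hy.2]⟩
    have hpi : -Real.pi ∈ Icc (-Real.pi) Real.pi := ⟨le_rfl, by linarith [Real.pi_pos]⟩
    have he := (eVariationOn.eq_zero_iff _).1 h0 y hy' _ hpi
    rw [hxy, ← hz]
    exact edist_eq_zero.1 he

instance : NormedAddCommGroup NBV := NBV.addGroupNorm.toNormedAddCommGroup

instance : NormedSpace ℝ NBV where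
  norm_smul_le c f := by
    change (variation (c • f.toFun)).toReal ≤ ‖c‖ * (variation f.toFun).toReal
    rw [variation_smul, ENNReal.toReal_mul, toReal_enorm]

/-! ### The harmonic Hardy space `h^BV` -/

/-- `‖u‖_BV = sup_{0 ≤ r < 1} V u_r`, as an extended nonnegative real. -/
def hardyVariation (u : Disc → ℝ) : ℝ≥0∞ :=
  ⨆ r ∈ Ico (0 : ℝ) 1, variation (slice u r)

lemma extendZero_add (u v : Disc → ℝ) : extendZero (u + v) = extendZero u + extendZero v := by
  ext z
  by_cases h : z ∈ Metric.ball (0 : ℂ) 1 <;> simp only [extendZero, Pi.add_apply, h, dite_true,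
    dite_false, add_zero]

lemma extendZero_smul (c : ℝ) (u : Disc → ℝ) : extendZero (c • u) = c • extendZero u := by
  ext z
  by_cases h : z ∈ Metric.ball (0 : ℂ) 1 <;> simp only [extendZero, Pi.smul_apply, h, dite_true,
    dite_false, smul_zero]

lemma extendZero_zero : extendZero 0 = 0 := by
  ext z
  simp [extendZero]

lemma hardyVariation_zero : hardyVariation 0 = 0 := by
  have h : ∀ r, slice 0 r = 0 := fun r => by
    funext θ
    simp [slice, extendZero_zero]
  simp [hardyVariation, h, variation_zero]

lemma hardyVariation_add_le (u v : Disc → ℝ) :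
    hardyVariation (u + v) ≤ hardyVariation u + hardyVariation v := by
  refine iSup₂_le fun r hr => ?_
  have h : slice (u + v) r = slice u r + slice v r := by
    funext θ
    simp [slice, extendZero_add]
  rw [h]
  exact (variation_add_le _ _).trans (add_le_add
    (le_iSup₂ (f := fun r (_ : r ∈ Ico (0 : ℝ) 1) => variation (slice u r)) r hr)
    (le_iSup₂ (f := fun r (_ : r ∈ Ico (0 : ℝ) 1) => variation (slice v r)) r hr))

lemma hardyVariation_smul (c : ℝ) (u : Disc → ℝ) :
    hardyVariation (c • u) = ‖c‖ₑ * hardyVariation u := by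
  have h : ∀ r, slice (c • u) r = c • slice u r := fun r => by
    funext θ
    simp [slice, extendZero_smul]
  simp only [hardyVariation, h, variation_smul, ENNReal.mul_iSup]

lemma hardyVariation_neg (u : Disc → ℝ) : hardyVariation (-u) = hardyVariation u := by
  have h := hardyVariation_smul (-1) u
  simpa using h

/-- `h^BV`, as a linear space of functions: `u : D → ℝ` is harmonic in `D`, with finite
`‖u‖_BV`. -/
def hbv : Submodule ℝ (Disc → ℝ) where
  carrier := {u | IsHarmonicOnDisc u ∧ hardyVariation u < ∞}
  zero_mem' := by
    refine ⟨?_, by rw [hardyVariation_zero]; exact ENNReal.zero_lt_top⟩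
    unfold IsHarmonicOnDisc
    rw [extendZero_zero]
    exact harmonicOnNhd_const 0
  add_mem' := by
    rintro u v ⟨hu, hu'⟩ ⟨hv, hv'⟩
    refine ⟨?_, (hardyVariation_add_le u v).trans_lt (ENNReal.add_lt_top.2 ⟨hu', hv'⟩)⟩
    unfold IsHarmonicOnDisc
    rw [extendZero_add]
    exact HarmonicOnNhd.add hu hv
  smul_mem' := by
    rintro c u ⟨hu, hu'⟩
    refine ⟨?_, ?_⟩
    · unfold IsHarmonicOnDisc
      rw [extendZero_smul]
      exact HarmonicOnNhd.const_smul hu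
    · rw [hardyVariation_smul]
      exact ENNReal.mul_lt_top enorm_lt_top hu'

/-- The space `h^BV` of functions, with the seminorm `‖u‖_BV`. The normed space belonging to it is
its separation quotient, in which functions at distance zero are identified. -/
def HBV : Type := hbv

instance : AddCommGroup HBV := inferInstanceAs (AddCommGroup hbv)

instance : Module ℝ HBV := inferInstanceAs (Module ℝ hbv)

/-- The function underlying an element of `HBV`. -/
def HBV.toFun (u : HBV) : Disc → ℝ := Subtype.val (p := fun u => u ∈ hbv) u

/-- `‖u‖_BV`, as a real number, is a seminorm on `h^BV`. -/
def HBV.addGroupSeminorm : AddGroupSeminorm HBV where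
  toFun u := (hardyVariation u.toFun).toReal
  map_zero' := by
    change (hardyVariation 0).toReal = 0
    simp [hardyVariation_zero]
  add_le' u v := by
    have hu : hardyVariation u.toFun < ∞ := u.2.2
    have hv : hardyVariation v.toFun < ∞ := v.2.2
    rw [← ENNReal.toReal_add hu.ne hv.ne]
    exact ENNReal.toReal_mono (ENNReal.add_lt_top.2 ⟨hu, hv⟩).ne (hardyVariation_add_le _ _)
  neg' u := by
    change (hardyVariation (-u.toFun)).toReal = _
    rw [hardyVariation_neg]

instance : SeminormedAddCommGroup HBV := HBV.addGroupSeminorm.toSeminormedAddCommGroup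

instance : NormedSpace ℝ HBV where
  norm_smul_le c u := by
    change (hardyVariation (c • u.toFun)).toReal ≤ ‖c‖ * (hardyVariation u.toFun).toReal
    rw [hardyVariation_smul, ENNReal.toReal_mul, toReal_enorm]

/-! ### The Henstock–Kurzweil integral over a period -/

/-- The interval `[-π, π]`, as a one-dimensional box. -/
def periodBox : BoxIntegral.Box (Fin 1) where
  lower _ := -Real.pi
  upper _ := Real.pi
  lower_lt_upper _ := by linarith [Real.pi_pos]

/-- `f` is Henstock–Kurzweil integrable over `[-π, π]`. -/
def HKIntegrable (f : ℝ → ℝ) : Prop :=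
  BoxIntegral.Integrable periodBox BoxIntegral.IntegrationParams.Henstock
    (fun x : Fin 1 → ℝ => f (x 0)) (volume : Measure (Fin 1 → ℝ)).toBoxAdditive.toSMul

/-- The Henstock–Kurzweil integral of `f` over `[-π, π]`. -/
def hkIntegral (f : ℝ → ℝ) : ℝ :=
  BoxIntegral.integral periodBox BoxIntegral.IntegrationParams.Henstock
    (fun x : Fin 1 → ℝ => f (x 0)) (volume : Measure (Fin 1 → ℝ)).toBoxAdditive.toSMul

/-- The class `HK`: the `2π`-periodic functions that are Henstock–Kurzweil integrable over a
period. -/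
def IsHK (f : ℝ → ℝ) : Prop :=
  Function.Periodic f (2 * Real.pi) ∧ HKIntegrable f

end PoissonBV

end

/-!
For `0 ≤ r < 1` the slice at radius `r` of `P[g]` is the average of the translates of `g` with
respect to the probability measure `Φ_r(ψ) dψ`. Since the variation over a period is translation
invariant and convex, this bounds the variation and the size of the slices.

For a Henstock–Kurzweil integrable `f` with primitive `F`, summation by parts in the Riemann sums
gives `|∫ f g| ≤ sup |F| · (|g(π)| + V g)`. The left side is thus controlled uniformly over bounded
sets of functions `g` of bounded variation, and `f` can be approximated, in the norm `sup |F|`, by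
continuous functions; for these, dominated convergence gives the weak* convergence of the slices.
Convergence in variation fails at a jump, because the slices are continuous.

Conversely, if `u` is harmonic and its slices have variation at most `V`, Tychonoff's theorem yields
a pointwise cluster point `g` of the slices as `r → 1⁻`, and `V g ≤ V`. On the functions of
variation at most `V`, integration against a continuous kernel is continuous for pointwise
convergence, being a uniform limit of finite sums. So the Poisson formula on the discs of radius
`r < 1` passes to the limit and `u = P[g]`. Replacing `g` by its right limits and subtracting a
constant makes it normalised, and right continuity makes the variation of `g` the supremum of the
variations of the slices.
-/

noncomputable section

namespace PoissonBV

/-! ### Bounded variation over a period -/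

section Variation

variable {E : Type*} [PseudoEMetricSpace E] {g : ℝ → E} {T : ℝ}

lemma eVariationOn_comp_add_const (g : ℝ → E) (a b c : ℝ) :
    eVariationOn (fun x => g (x + c)) (Icc a b) = eVariationOn g (Icc (a + c) (b + c)) := by
  rw [← image_add_const_Icc]
  exact eVariationOn.comp_eq_of_monotoneOn g (· + c) fun x _ y _ h => by simpa using h

lemma eVariationOn_Icc_add_period (hg : Function.Periodic g T) (a b : ℝ) :
    eVariationOn g (Icc (a + T) (b + T)) = eVariationOn g (Icc a b) := by
  rw [← eVariationOn_comp_add_const, funext hg]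

lemma eVariationOn_Icc_nat_mul_period (hg : Function.Periodic g T) (hT : 0 ≤ T) (a : ℝ) (n : ℕ) :
    eVariationOn g (Icc a (a + n * T)) = n * eVariationOn g (Icc a (a + T)) := by
  have hmono : Monotone fun i : ℕ => a + i * T := fun i j hij => by
    simp only
    gcongr
  have hterm (i : ℕ) :
      eVariationOn g (Icc (a + i * T) (a + (i + 1 : ℕ) * T)) = eVariationOn g (Icc a (a + T)) := by
    rw [← eVariationOn_Icc_add_period (hg.nat_mul i) a, Nat.cast_succ, add_one_mul,
      add_right_comm, ← add_assoc]
  simpa only [hterm, Finset.sum_const, Finset.card_range, nsmul_eq_mul, Nat.cast_zero, zero_mul,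
    add_zero] using (eVariationOn.sum' g hmono (n := n)).symm

lemma eVariationOn_Icc_period_eq (hg : Function.Periodic g T) (hT : 0 < T) (a b : ℝ) :
    eVariationOn g (Icc a (a + T)) = eVariationOn g (Icc b (b + T)) := by
  obtain ⟨n, hn, -⟩ := existsUnique_add_zsmul_mem_Ico hT a b
  set c := a + n • T with hc
  have hca : eVariationOn g (Icc c (c + T)) = eVariationOn g (Icc a (a + T)) := by
    rw [← eVariationOn_Icc_add_period (hg.zsmul n) a, hc, add_right_comm]
  have hsplit_b := eVariationOn.Icc_add_Icc g hn.1 hn.2.le (mem_univ c)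
  have hsplit_c := eVariationOn.Icc_add_Icc g (c := c + T) hn.2.le (by linarith [hn.1])
    (mem_univ (b + T))
  simp only [univ_inter] at hsplit_b hsplit_c
  rw [← hca, ← hsplit_b, ← hsplit_c, eVariationOn_Icc_add_period hg, add_comm]

lemma locallyBoundedVariationOn_of_periodic (hg : Function.Periodic g T) (hT : 0 < T) {c : ℝ}
    (hV : BoundedVariationOn g (Icc c (c + T))) : LocallyBoundedVariationOn g univ := by
  intro a b _ _
  obtain ⟨n, hn⟩ := exists_nat_ge ((b - a) / T)
  rw [div_le_iff₀ hT] at hn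
  rw [univ_inter]
  refine BoundedVariationOn.mono ?_ (Icc_subset_Icc_right (by linarith : b ≤ a + n * T))
  rw [BoundedVariationOn, eVariationOn_Icc_nat_mul_period hg hT.le,
    eVariationOn_Icc_period_eq hg hT a c]
  exact ENNReal.mul_ne_top (ENNReal.natCast_ne_top n) hV

lemma eVariationOn_le_of_tendsto {α ι : Type*} [LinearOrder α] {F : ι → α → E} {f : α → E}
    {s : Set α} {p : Filter ι} [p.NeBot] (hF : ∀ x ∈ s, Tendsto (fun i => F i x) p (𝓝 (f x)))
    {C : ℝ≥0∞} (hC : ∀ᶠ i in p, eVariationOn (F i) s ≤ C) : eVariationOn f s ≤ C := by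
  by_contra! h
  obtain ⟨i, hlt, hle⟩ := ((eVariationOn.lowerSemicontinuous_aux hF h).and hC).exists
  exact hlt.not_ge hle

end Variation

lemma eVariationOn_integral_le {α β E : Type*} [MeasurableSpace α] {μ : Measure α} [LinearOrder β]
    [NormedAddCommGroup E] [NormedSpace ℝ E] {G : α → β → E} {s : Set β}
    (hG : ∀ t ∈ s, Integrable (fun x => G x t) μ) :
    eVariationOn (fun t => ∫ x, G x t ∂μ) s ≤ ∫⁻ x, eVariationOn (G x) s ∂μ := by
  refine iSup_le fun ⟨n, u, hu, hus⟩ => ?_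
  have hint (i : ℕ) : Integrable (fun x => G x (u i)) μ := hG _ (hus i)
  calc ∑ i ∈ Finset.range n, edist (∫ x, G x (u (i + 1)) ∂μ) (∫ x, G x (u i) ∂μ)
      ≤ ∑ i ∈ Finset.range n, ∫⁻ x, edist (G x (u (i + 1))) (G x (u i)) ∂μ := by
        gcongr with i
        simp_rw [edist_eq_enorm_sub, ← integral_sub (hint (i + 1)) (hint i)]
        exact enorm_integral_le_lintegral_enorm _
    _ = ∫⁻ x, ∑ i ∈ Finset.range n, edist (G x (u (i + 1))) (G x (u i)) ∂μ :=
        (lintegral_finsetSum' _ fun i _ => (hint (i + 1)).1.edist (hint i).1).symm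
    _ ≤ ∫⁻ x, eVariationOn (G x) s ∂μ := lintegral_mono fun x => eVariationOn.sum_le hu hus

section RealVariation

variable {g : ℝ → ℝ}

lemma intervalIntegrable_of_boundedVariationOn {a b : ℝ} (hg : BoundedVariationOn g (uIcc a b)) :
    IntervalIntegrable g volume a b := by
  obtain ⟨p, q, hp, hq, rfl⟩ := hg.locallyBoundedVariationOn.exists_monotoneOn_sub_monotoneOn
  exact hp.intervalIntegrable.sub hq.intervalIntegrable

lemma countable_not_continuousAt_of_locallyBoundedVariationOn
    (hg : LocallyBoundedVariationOn g univ) : {x | ¬ContinuousAt g x}.Countable := by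
  obtain ⟨p, q, hp, hq, rfl⟩ := hg.exists_monotoneOn_sub_monotoneOn
  rw [monotoneOn_univ] at hp hq
  refine (hp.countable_not_continuousAt.union hq.countable_not_continuousAt).mono ?_
  exact fun x hx => not_and_or.1 fun h => hx (h.1.sub h.2)

lemma variation_const (c : ℝ) : variation (fun _ => c) = 0 :=
  eVariationOn.constant_on (subsingleton_singleton.anti (image_subset_iff.2 fun _ _ => rfl))

lemma eVariationOn_Icc_two_pi (hg : Function.Periodic g (2 * Real.pi)) (a : ℝ) :
    eVariationOn g (Icc a (a + 2 * Real.pi)) = variation g := by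
  rw [eVariationOn_Icc_period_eq hg Real.two_pi_pos a (-Real.pi), variation]
  ring_nf

lemma variation_comp_add_const (hg : Function.Periodic g (2 * Real.pi)) (c : ℝ) :
    variation (fun x => g (x + c)) = variation g := by
  rw [variation, eVariationOn_comp_add_const, ← eVariationOn_Icc_two_pi hg (-Real.pi + c)]
  ring_nf

lemma edist_le_variation (hg : Function.Periodic g (2 * Real.pi)) (x y : ℝ) :
    edist (g x) (g y) ≤ variation g := by
  obtain ⟨y', hy', hy⟩ := hg.exists_mem_Ico Real.two_pi_pos y x
  rw [hy, ← eVariationOn_Icc_two_pi hg x]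
  exact eVariationOn.edist_le g (left_mem_Icc.2 (by linarith [Real.two_pi_pos]))
    (Ico_subset_Icc_self hy')

lemma edist_le_variation_of_tendsto (hg : Function.Periodic g (2 * Real.pi)) {l l' : Filter ℝ}
    [l.NeBot] [l'.NeBot] {a b : ℝ} (ha : Tendsto g l (𝓝 a)) (hb : Tendsto g l' (𝓝 b)) :
    edist a b ≤ variation g :=
  le_of_tendsto ((ha.comp tendsto_fst).edist (hb.comp tendsto_snd) :
    Tendsto (fun z : ℝ × ℝ => edist (g z.1) (g z.2)) (l ×ˢ l') _)
    (Eventually.of_forall fun z => edist_le_variation hg z.1 z.2)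

namespace IsBV

lemma locallyBoundedVariationOn (hg : IsBV g) : LocallyBoundedVariationOn g univ :=
  locallyBoundedVariationOn_of_periodic hg.1 Real.two_pi_pos (c := -Real.pi)
    ((eVariationOn_Icc_two_pi hg.1 _).trans_lt hg.2).ne

lemma intervalIntegrable (hg : IsBV g) (a b : ℝ) : IntervalIntegrable g volume a b :=
  intervalIntegrable_of_boundedVariationOn <| by
    simpa only [univ_inter, uIcc] using
      hg.locallyBoundedVariationOn _ _ (mem_univ (a ⊓ b)) (mem_univ _)

lemma countable_not_continuousAt (hg : IsBV g) : {x | ¬ContinuousAt g x}.Countable :=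
  countable_not_continuousAt_of_locallyBoundedVariationOn hg.locallyBoundedVariationOn

lemma abs_sub_le (hg : IsBV g) (x y : ℝ) : |g x - g y| ≤ (variation g).toReal := by
  rw [← Real.dist_eq, dist_edist]
  exact ENNReal.toReal_mono hg.2.ne (edist_le_variation hg.1 x y)

lemma abs_le (hg : IsBV g) (x y : ℝ) : |g x| ≤ |g y| + (variation g).toReal := by
  linarith [hg.abs_sub_le x y, abs_sub_abs_le_abs_sub (g x) (g y)]

end IsBV

end RealVariation

/-! ### The Poisson kernel -/

section Kernel

variable {r : ℝ}

lemma polarPoissonKernel_denom_pos (hr : r ∈ Ico (0 : ℝ) 1) (θ : ℝ) :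
    0 < 1 - 2 * r * Real.cos θ + r ^ 2 := by
  nlinarith [mul_nonneg hr.1 (sub_nonneg.2 (Real.cos_le_one θ)), sq_pos_of_pos (sub_pos.2 hr.2)]

lemma polarPoissonKernel_nonneg (hr : r ∈ Ico (0 : ℝ) 1) (θ : ℝ) :
    0 ≤ polarPoissonKernel r θ :=
  div_nonneg (by nlinarith [hr.1, hr.2])
    (mul_nonneg Real.two_pi_pos.le (polarPoissonKernel_denom_pos hr θ).le)

lemma continuous_polarPoissonKernel (hr : r ∈ Ico (0 : ℝ) 1) :
    Continuous (polarPoissonKernel r) :=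
  Continuous.div (by fun_prop) (by fun_prop) fun θ =>
    mul_ne_zero Real.two_pi_pos.ne' (polarPoissonKernel_denom_pos hr θ).ne'

lemma periodic_polarPoissonKernel (r : ℝ) :
    Function.Periodic (polarPoissonKernel r) (2 * Real.pi) := fun θ => by
  simp only [polarPoissonKernel, Real.cos_add_two_pi]

lemma periodic_mul_polarPoissonKernel_sub {g : ℝ → ℝ} (hg : Function.Periodic g (2 * Real.pi))
    (r θ : ℝ) :
    Function.Periodic (fun φ => g φ * polarPoissonKernel r (φ - θ)) (2 * Real.pi) :=
  hg.mul ((periodic_polarPoissonKernel r).sub_const θ)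

lemma norm_circleMap_sub_circleMap_sq (r θ φ : ℝ) :
    ‖circleMap 0 1 φ - circleMap 0 r θ‖ ^ 2 = 1 - 2 * r * Real.cos (φ - θ) + r ^ 2 := by
  have h : circleMap 0 1 φ - circleMap 0 r θ = ((Real.cos φ - r * Real.cos θ : ℝ) : ℂ)
      + ((Real.sin φ - r * Real.sin θ : ℝ) : ℂ) * Complex.I := by
    simp only [circleMap, Complex.exp_mul_I]
    push_cast
    ring
  rw [h, Complex.norm_add_mul_I, Real.sq_sqrt (by positivity), Real.cos_sub]
  nlinarith [Real.sin_sq_add_cos_sq φ, Real.sin_sq_add_cos_sq θ]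

lemma polarPoissonKernel_sub_eq (r θ φ : ℝ) :
    polarPoissonKernel r (φ - θ) =
      (2 * Real.pi)⁻¹ * poissonKernel 0 (circleMap 0 r θ) (circleMap 0 1 φ) := by
  rw [poissonKernel_def, sub_zero, sub_zero, norm_circleMap_sub_circleMap_sq, polarPoissonKernel,
    norm_circleMap_zero, norm_circleMap_zero, abs_one, one_pow, sq_abs, inv_mul_eq_div, div_div,
    mul_comm (2 * Real.pi)]

lemma poissonKernel_zero_mul_mul {c : ℂ} (hc : c ≠ 0) (w z : ℂ) :
    poissonKernel 0 (c * w) (c * z) = poissonKernel 0 w z := by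
  simp only [poissonKernel_def, sub_zero, ← mul_sub, norm_mul, mul_pow]
  exact mul_div_mul_left _ _ (pow_ne_zero 2 (norm_ne_zero_iff.2 hc))

lemma circleMap_norm_arg (w : ℂ) : circleMap 0 ‖w‖ (Complex.arg w) = w := by
  simp [circleMap]

lemma circleMap_mem_ball (hr : r ∈ Ico (0 : ℝ) 1) (θ : ℝ) :
    circleMap 0 r θ ∈ Metric.ball (0 : ℂ) 1 := by
  simpa [abs_of_nonneg hr.1] using hr.2

lemma intervalIntegral_two_pi {f : ℝ → ℝ} (hf : Function.Periodic f (2 * Real.pi)) (a : ℝ) :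
    ∫ x in a..a + 2 * Real.pi, f x = ∫ x in (-Real.pi)..Real.pi, f x := by
  rw [hf.intervalIntegral_add_eq a (-Real.pi)]
  ring_nf

lemma intervalIntegrable_of_two_pi {f : ℝ → ℝ} (hf : Function.Periodic f (2 * Real.pi))
    (hint : IntervalIntegrable f volume (-Real.pi) Real.pi) (a b : ℝ) :
    IntervalIntegrable f volume a b :=
  hf.intervalIntegrable Real.two_pi_pos.ne' (t := -Real.pi) (by ring_nf; exact hint) a b

lemma intervalIntegrable_comp_add_const {f : ℝ → ℝ} (hf : Function.Periodic f (2 * Real.pi))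
    (hint : IntervalIntegrable f volume (-Real.pi) Real.pi) (a b c : ℝ) :
    IntervalIntegrable (fun x => f (x + c)) volume a b := by
  simpa using (intervalIntegrable_of_two_pi hf hint (a + c) (b + c)).comp_add_right c

lemma integral_polarPoissonKernel (hr : r ∈ Ico (0 : ℝ) 1) :
    ∫ ψ in (-Real.pi)..Real.pi, polarPoissonKernel r ψ = 1 := by
  have h := HarmonicOnNhd.circleAverage_poissonKernel_smul (f := fun _ => (1 : ℝ))
    (harmonicOnNhd_const 1) (circleMap_mem_ball hr 0)
  rw [← intervalIntegral_two_pi (periodic_polarPoissonKernel r) 0, zero_add, ← h,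
    Real.circleAverage_def, ← intervalIntegral.integral_smul]
  refine intervalIntegral.integral_congr fun φ _ => ?_
  rw [← sub_zero φ, polarPoissonKernel_sub_eq r 0 φ, sub_zero]
  simp only [Pi.smul_apply', smul_eq_mul, mul_one]

end Kernel

/-! ### Poisson integrals as averages of translates -/

/-- The probability measure `Φ_r(ψ) dψ` on `(-π, π]`, against which the slice at radius `r` of a
Poisson integral averages the translates of the boundary function. -/
def poissonMeasure (r : ℝ) : Measure ℝ :=
  (volume.restrict (Ioc (-Real.pi) Real.pi)).withDensity
    fun ψ => ENNReal.ofReal (polarPoissonKernel r ψ)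

section Slices

variable {g : ℝ → ℝ} {r : ℝ}

lemma integral_poissonMeasure (hr : r ∈ Ico (0 : ℝ) 1) (h : ℝ → ℝ) :
    ∫ ψ, h ψ ∂poissonMeasure r =
      ∫ ψ in (-Real.pi)..Real.pi, h ψ * polarPoissonKernel r ψ := by
  have hmeas := (continuous_polarPoissonKernel hr).measurable.ennreal_ofReal
  rw [poissonMeasure, integral_withDensity_eq_integral_toReal_smul hmeas
      (Eventually.of_forall fun _ => ENNReal.ofReal_lt_top),
    intervalIntegral.integral_of_le (by linarith [Real.pi_pos])]
  simp only [ENNReal.toReal_ofReal (polarPoissonKernel_nonneg hr _), smul_eq_mul, mul_comm]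

lemma isProbabilityMeasure_poissonMeasure (hr : r ∈ Ico (0 : ℝ) 1) :
    IsProbabilityMeasure (poissonMeasure r) := by
  have hπ : -Real.pi ≤ Real.pi := by linarith [Real.pi_pos]
  constructor
  rw [poissonMeasure, withDensity_apply _ MeasurableSet.univ, Measure.restrict_univ,
    ← ofReal_integral_eq_lintegral_ofReal
      (((continuous_polarPoissonKernel hr).intervalIntegrable _ _).1)
      (Eventually.of_forall (polarPoissonKernel_nonneg hr)),
    ← intervalIntegral.integral_of_le hπ, integral_polarPoissonKernel hr, ENNReal.ofReal_one]

lemma integrable_poissonMeasure (hr : r ∈ Ico (0 : ℝ) 1)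
    (hint : IntervalIntegrable g volume (-Real.pi) Real.pi) : Integrable g (poissonMeasure r) := by
  have hmeas := (continuous_polarPoissonKernel hr).measurable.ennreal_ofReal
  rw [poissonMeasure, integrable_withDensity_iff_integrable_smul' hmeas
      (Eventually.of_forall fun _ => ENNReal.ofReal_lt_top)]
  simp only [ENNReal.toReal_ofReal (polarPoissonKernel_nonneg hr _), smul_eq_mul]
  exact (hint.continuousOn_mul (continuous_polarPoissonKernel hr).continuousOn).1

lemma slice_eq (hr : r ∈ Ico (0 : ℝ) 1) (u : Disc → ℝ) (θ : ℝ) :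
    slice u r θ = u ⟨circleMap 0 r θ, circleMap_mem_ball hr θ⟩ :=
  dif_pos (circleMap_mem_ball hr θ)

lemma periodic_slice (u : Disc → ℝ) (r : ℝ) : Function.Periodic (slice u r) (2 * Real.pi) :=
  fun θ => by simp only [slice, periodic_circleMap 0 r θ]

lemma slice_poissonIntegral (hg : Function.Periodic g (2 * Real.pi)) (hr : r ∈ Ico (0 : ℝ) 1)
    (θ : ℝ) : slice (poissonIntegral g) r θ =
      ∫ ψ in (-Real.pi)..Real.pi, g (ψ + θ) * polarPoissonKernel r ψ := by
  have hpolar : slice (poissonIntegral g) r θ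
      = ∫ φ in (-Real.pi)..Real.pi, g φ * polarPoissonKernel r (φ - θ) := by
    rw [slice_eq hr, poissonIntegral]
    simp only [polarPoissonKernel_sub_eq, circleMap_norm_arg]
  have hshift := intervalIntegral.integral_comp_add_right (a := -Real.pi) (b := Real.pi)
    (fun φ => g φ * polarPoissonKernel r (φ - θ)) θ
  simp only [add_sub_cancel_right] at hshift
  rw [hpolar, hshift,
    ← intervalIntegral_two_pi (periodic_mul_polarPoissonKernel_sub hg r θ) (-Real.pi + θ)]
  ring_nf

lemma slice_poissonIntegral_eq_integral (hg : Function.Periodic g (2 * Real.pi))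
    (hr : r ∈ Ico (0 : ℝ) 1) (θ : ℝ) :
    slice (poissonIntegral g) r θ = ∫ ψ, g (ψ + θ) ∂poissonMeasure r := by
  rw [slice_poissonIntegral hg hr, integral_poissonMeasure hr]

lemma abs_slice_poissonIntegral_le (hg : Function.Periodic g (2 * Real.pi)) {C : ℝ}
    (hC : ∀ x, |g x| ≤ C) (hr : r ∈ Ico (0 : ℝ) 1) (θ : ℝ) :
    |slice (poissonIntegral g) r θ| ≤ C := by
  have := isProbabilityMeasure_poissonMeasure hr
  rw [slice_poissonIntegral_eq_integral hg hr]
  simpa using norm_integral_le_of_norm_le_const (μ := poissonMeasure r)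
    (Eventually.of_forall fun ψ => (Real.norm_eq_abs _).trans_le (hC (ψ + θ)))

lemma iSup_enorm_slice_poissonIntegral_le (hg : IsBV g) (hr : r ∈ Ico (0 : ℝ) 1) :
    (⨆ θ : ℝ, ‖slice (poissonIntegral g) r θ‖ₑ) ≤ (⨅ θ : ℝ, ‖g θ‖ₑ) + variation g := by
  rw [ENNReal.iInf_add]
  refine iSup_le fun θ => le_iInf fun y => ?_
  rw [← ENNReal.ofReal_toReal hg.2.ne, Real.enorm_eq_ofReal_abs, Real.enorm_eq_ofReal_abs,
    ← ENNReal.ofReal_add (abs_nonneg _) ENNReal.toReal_nonneg]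
  exact ENNReal.ofReal_le_ofReal (abs_slice_poissonIntegral_le hg.1 (hg.abs_le · y) hr θ)

lemma iSup_enorm_slice_poissonIntegral_le_variation (hg : g ∈ nbv) (hr : r ∈ Ico (0 : ℝ) 1) :
    (⨆ θ : ℝ, ‖slice (poissonIntegral g) r θ‖ₑ) ≤ variation g := by
  have hinf : (⨅ θ : ℝ, ‖g θ‖ₑ) = 0 :=
    nonpos_iff_eq_zero.1 ((iInf_le _ (-Real.pi)).trans_eq (by rw [hg.2.1, enorm_zero]))
  simpa only [hinf, zero_add] using iSup_enorm_slice_poissonIntegral_le hg.1 hr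

lemma variation_slice_poissonIntegral_le (hg : Function.Periodic g (2 * Real.pi))
    (hint : IntervalIntegrable g volume (-Real.pi) Real.pi) (hr : r ∈ Ico (0 : ℝ) 1) :
    variation (slice (poissonIntegral g) r) ≤ variation g := by
  have := isProbabilityMeasure_poissonMeasure hr
  have hvar (ψ : ℝ) : variation (fun θ => g (ψ + θ)) = variation g := by
    simpa only [add_comm] using variation_comp_add_const hg ψ
  calc variation (slice (poissonIntegral g) r)
      = variation fun θ => ∫ ψ, g (ψ + θ) ∂poissonMeasure r := by
        rw [funext (slice_poissonIntegral_eq_integral hg hr)]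
    _ ≤ ∫⁻ ψ, variation (fun θ => g (ψ + θ)) ∂poissonMeasure r :=
        eVariationOn_integral_le fun θ _ =>
          integrable_poissonMeasure hr (intervalIntegrable_comp_add_const hg hint _ _ θ)
    _ = variation g := by simp only [hvar, lintegral_const, measure_univ, mul_one]

end Slices

/-! ### Boundary behaviour -/

lemma tendstoUniformlyOn_polarPoissonKernel {U : Set ℝ} (hU : IsOpen U) (h0 : (0 : ℝ) ∈ U) :
    TendstoUniformlyOn polarPoissonKernel 0 (𝓝[<] 1) (Ioc (-Real.pi) Real.pi \ U) := by
  obtain ⟨δ, hδ, hδU⟩ := Metric.isOpen_iff.1 hU 0 h0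
  set d := min δ Real.pi
  have hd : 0 < d := lt_min hδ Real.pi_pos
  have hcos_d : 0 < 1 - Real.cos d := sub_pos.2 <|
    Real.cos_zero ▸ Real.cos_lt_cos_of_nonneg_of_le_pi le_rfl (min_le_right δ Real.pi) hd
  have hlim : Tendsto (fun r : ℝ => (1 - r ^ 2) / (2 * Real.pi * (1 - Real.cos d))) (𝓝[<] 1)
      (𝓝 0) := by
    have h : Continuous fun r : ℝ => (1 - r ^ 2) / (2 * Real.pi * (1 - Real.cos d)) := by fun_prop
    simpa using (h.tendsto 1).mono_left nhdsWithin_le_nhds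
  rw [Metric.tendstoUniformlyOn_iff]
  intro ε hε
  filter_upwards [hlim.eventually_lt_const hε, Ioo_mem_nhdsLT (show (1 / 2 : ℝ) < 1 by norm_num)]
    with r hlt hr ψ hψ
  have hr01 : r ∈ Ico (0 : ℝ) 1 := ⟨by linarith [hr.1], hr.2⟩
  have hcos : Real.cos ψ ≤ Real.cos d := by
    have hdψ : d ≤ |ψ| := (min_le_left _ _).trans <| not_lt.1 fun h =>
      hψ.2 (hδU (by rwa [Metric.mem_ball, Real.dist_0_eq_abs]))
    rw [← Real.cos_abs ψ]
    exact Real.cos_le_cos_of_nonneg_of_le_pi hd.le (abs_le.2 ⟨hψ.1.1.le, hψ.1.2⟩) hdψ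
  rw [Pi.zero_apply, dist_comm, Real.dist_0_eq_abs,
    abs_of_nonneg (polarPoissonKernel_nonneg hr01 ψ)]
  refine lt_of_le_of_lt ?_ hlt
  unfold polarPoissonKernel
  gcongr
  · nlinarith [hr01.1, hr01.2]
  · nlinarith [sq_nonneg (1 - r), hr.1]

lemma eventually_mem_Ico_zero_one : ∀ᶠ r in 𝓝[<] (1 : ℝ), r ∈ Ico (0 : ℝ) 1 :=
  Ico_mem_nhdsLT zero_lt_one

lemma tendsto_slice_poissonIntegral {g : ℝ → ℝ} (hg : Function.Periodic g (2 * Real.pi))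
    (hint : IntervalIntegrable g volume (-Real.pi) Real.pi) {θ : ℝ} (hθ : ContinuousAt g θ) :
    Tendsto (fun r => slice (poissonIntegral g) r θ) (𝓝[<] 1) (𝓝 (g θ)) := by
  have hπ : -Real.pi ≤ Real.pi := by linarith [Real.pi_pos]
  have hev := eventually_mem_Ico_zero_one
  have htranslate : Tendsto (fun ψ => g (ψ + θ)) (𝓝[Ioc (-Real.pi) Real.pi] 0) (𝓝 (g θ)) := by
    refine Tendsto.mono_left ?_ nhdsWithin_le_nhds
    exact hθ.tendsto.comp (Continuous.tendsto' (by fun_prop) _ _ (zero_add θ))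
  refine (tendsto_setIntegral_peak_smul_of_integrableOn_of_tendsto (μ := volume)
    (φ := polarPoissonKernel) measurableSet_Ioc measurableSet_Ioc subset_rfl self_mem_nhdsWithin
    (by simp) (hev.mono fun r hr ψ _ => polarPoissonKernel_nonneg hr ψ)
    (fun U hU h0 => tendstoUniformlyOn_polarPoissonKernel hU h0)
    (tendsto_const_nhds.congr' (hev.mono fun r hr => ?_))
    (hev.mono fun r hr => (continuous_polarPoissonKernel hr).aestronglyMeasurable)
    (intervalIntegrable_comp_add_const hg hint _ _ θ).1 htranslate).congr' (hev.mono fun r hr => ?_)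
  · simp only [← intervalIntegral.integral_of_le hπ, integral_polarPoissonKernel hr]
  · simp only [slice_poissonIntegral hg hr, intervalIntegral.integral_of_le hπ, smul_eq_mul,
      mul_comm]

/-! ### Harmonicity -/

lemma apply_arg_circleMap {g : ℝ → ℝ} (hg : Function.Periodic g (2 * Real.pi)) (φ : ℝ) :
    g (Complex.arg (circleMap 0 1 φ)) = g φ := by
  rw [circleMap_zero, Complex.ofReal_one, one_mul, Complex.arg_exp_mul_I]
  conv_rhs => rw [← toIocMod_add_toIocDiv_zsmul Real.two_pi_pos (-Real.pi) φ]
  exact (hg.zsmul _ _).symm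

lemma poissonIntegral_eq_circleAverage {g : ℝ → ℝ} (hg : Function.Periodic g (2 * Real.pi))
    (w : Disc) : poissonIntegral g w = Real.circleAverage
      (poissonKernel 0 (w : ℂ) • fun z => g (Complex.arg z)) 0 1 := by
  rw [Real.circleAverage_def, poissonIntegral,
    ← intervalIntegral_two_pi (periodic_mul_polarPoissonKernel_sub hg _ _) 0, zero_add,
    ← intervalIntegral.integral_smul]
  refine intervalIntegral.integral_congr fun φ _ => ?_
  simp only [polarPoissonKernel_sub_eq, circleMap_norm_arg, Pi.smul_apply',
    apply_arg_circleMap hg, smul_eq_mul]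
  ring

lemma circleIntegrable_comp_arg {g : ℝ → ℝ} (hg : Function.Periodic g (2 * Real.pi))
    (hint : IntervalIntegrable g volume (-Real.pi) Real.pi) :
    CircleIntegrable (fun z => g (Complex.arg z)) 0 1 := by
  simp only [CircleIntegrable, apply_arg_circleMap hg]
  exact intervalIntegrable_of_two_pi hg hint _ _

lemma isHarmonicOnDisc_poissonIntegral {g : ℝ → ℝ} (hg : Function.Periodic g (2 * Real.pi))
    (hint : IntervalIntegrable g volume (-Real.pi) Real.pi) :
    IsHarmonicOnDisc (poissonIntegral g) := by
  have hreal := circleIntegrable_comp_arg hg hint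
  have hcomplex : CircleIntegrable (fun z => (g (Complex.arg z) : ℂ)) 0 1 := by
    simp only [CircleIntegrable, intervalIntegrable_iff] at hreal ⊢
    exact Complex.ofRealCLM.integrable_comp hreal
  intro w hw
  refine (harmonicAt_congr_nhds ?_).2
    (analyticOnNhd_circleAverage_herglotzRieszKernel_smul hcomplex w hw).harmonicAt_re
  filter_upwards [Metric.isOpen_ball.mem_nhds hw] with z hz
  rw [re_circleAverage_herglotzRieszKernel_smul hreal hz, ← poissonKernel_eq_re_herglotzRieszKernel]
  exact (dif_pos hz).trans (poissonIntegral_eq_circleAverage hg ⟨z, hz⟩)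

namespace IsHarmonicOnDisc

lemma extendZero_mul_eq_poissonIntegral {u : Disc → ℝ} (hu : IsHarmonicOnDisc u) {ρ : ℝ}
    (hρ : ρ ∈ Ioo (0 : ℝ) 1) (z : Disc) :
    extendZero u (ρ * z) = poissonIntegral (slice u ρ) z := by
  have hz : (ρ : ℂ) * (z : ℂ) ∈ Metric.ball (0 : ℂ) ρ := by
    rw [mem_ball_zero_iff, norm_mul, Complex.norm_real, Real.norm_of_nonneg hρ.1.le]
    exact mul_lt_of_lt_one_right hρ.1 (mem_ball_zero_iff.1 z.2)
  rw [← HarmonicOnNhd.circleAverage_poissonKernel_smul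
      (HarmonicOnNhd.mono hu (Metric.closedBall_subset_ball hρ.2)) hz,
    poissonIntegral_eq_circleAverage (periodic_slice u ρ), Real.circleAverage_def,
    Real.circleAverage_def]
  congr 1
  refine intervalIntegral.integral_congr fun φ _ => ?_
  have hscale : circleMap 0 ρ φ = ρ * circleMap 0 1 φ := by simp [circleMap]
  rw [Pi.smul_apply', Pi.smul_apply', apply_arg_circleMap (periodic_slice u ρ), slice, hscale,
    poissonKernel_zero_mul_mul (Complex.ofReal_ne_zero.2 hρ.1.ne')]

end IsHarmonicOnDisc

/-! ### The Henstock–Kurzweil integral on an interval -/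

section HenstockKurzweil

open BoxIntegral

lemma memBaseSet_henstock_single {ι : Type*} [Fintype ι] {I J : Box ι} (hJ : J ≤ I) {t : ι → ℝ}
    (ht : t ∈ Box.Icc J) {c : NNReal} {r : (ι → ℝ) → Ioi (0 : ℝ)}
    (hr : Box.Icc J ⊆ Metric.closedBall t (r t)) :
    IntegrationParams.Henstock.MemBaseSet I c r
      (TaggedPrepartition.single I J hJ t (Box.le_iff_Icc.1 hJ ht)) where
  isSubordinate := (TaggedPrepartition.isSubordinate_single hJ _).2 hr
  isHenstock _ := (TaggedPrepartition.isHenstock_single_iff hJ _).2 ht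
  distortion_le h := absurd h (by decide)
  exists_compl h := absurd h (by decide)

lemma integrable_of_forall_eventually_dist_integralSum_le {ι E F : Type*} [Fintype ι]
    [NormedAddCommGroup E] [NormedSpace ℝ E] [NormedAddCommGroup F] [NormedSpace ℝ F]
    [CompleteSpace F] {I : Box ι} {l : IntegrationParams} {f : (ι → ℝ) → E}
    {vol : ι →ᵇᵃ E →L[ℝ] F}
    (h : ∀ ε > 0, ∃ q, BoxIntegral.Integrable I l q vol ∧ ∀ᶠ π in l.toFilteriUnion I ⊤,
      dist (integralSum f vol π) (integralSum q vol π) ≤ ε) :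
    BoxIntegral.Integrable I l f vol := by
  refine integrable_iff_cauchy.2 (Metric.cauchy_iff.2 ⟨inferInstance, fun ε hε => ?_⟩)
  obtain ⟨q, ⟨y, hq⟩, hfq⟩ := h (ε / 4) (by positivity)
  have hball : ∀ᶠ π in l.toFilteriUnion I ⊤, integralSum f vol π ∈ Metric.ball y (ε / 2) := by
    have hnhds := Metric.ball_mem_nhds y (by positivity : 0 < ε / 4)
    filter_upwards [hfq, hq.tendsto.eventually hnhds] with π hπ hπ'
    rw [Metric.mem_ball]
    linarith [dist_triangle (integralSum f vol π) (integralSum q vol π) y]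
  refine ⟨Metric.ball y (ε / 2), hball, fun a ha b hb => ?_⟩
  rw [Metric.mem_ball] at ha hb
  linarith [dist_triangle_right a b y]

lemma integralSum_sub {ι E F : Type*} [NormedAddCommGroup E] [NormedSpace ℝ E]
    [NormedAddCommGroup F] [NormedSpace ℝ F] {I : Box ι} (f g : (ι → ℝ) → E)
    (vol : ι →ᵇᵃ E →L[ℝ] F) (π : TaggedPrepartition I) :
    integralSum (f - g) vol π = integralSum f vol π - integralSum g vol π := by
  rw [sub_eq_add_neg, integralSum_add, integralSum_neg, sub_eq_add_neg]

lemma mem_Icc_box {J : Box (Fin 1)} {x : Fin 1 → ℝ} :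
    x ∈ Box.Icc J ↔ x 0 ∈ Icc (J.lower 0) (J.upper 0) := by
  simp [Box.Icc_def, Pi.le_def]

lemma box_le_iff {J K : Box (Fin 1)} :
    J ≤ K ↔ K.lower 0 ≤ J.lower 0 ∧ J.upper 0 ≤ K.upper 0 := by
  simp [Box.le_iff_bounds, Pi.le_def]

/-- The half-open interval `(a, b]` as a one-dimensional box. -/
def intervalBox (a b : ℝ) (h : a < b) : Box (Fin 1) where
  lower _ := a
  upper _ := b
  lower_lt_upper _ := h

lemma eq_intervalBox (J : Box (Fin 1)) :
    J = intervalBox (J.lower 0) (J.upper 0) (J.lower_lt_upper 0) := by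
  obtain ⟨l, u, h⟩ := J
  simp only [intervalBox, Box.mk.injEq]
  constructor <;> funext i <;> rw [Subsingleton.elim i 0]

lemma split_intervalBox {J : Box (Fin 1)} {x : ℝ} (hl : J.lower 0 < x) (hu : x < J.upper 0) :
    J.splitLower 0 x = intervalBox (J.lower 0) x hl ∧
      J.splitUpper 0 x = intervalBox x (J.upper 0) hu := by
  rw [Box.splitLower_def ⟨hl, hu⟩, Box.splitUpper_def ⟨hl, hu⟩]
  constructor <;> exact congrArg _ ((eq_intervalBox _).trans (by simp [intervalBox]))

lemma sum_boxes_eq_of_additive {M : Type*} [AddCommMonoid M] {φ : ℝ → ℝ → M}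
    (hφ : ∀ a b c, a < b → b < c → φ a b + φ b c = φ a c) {I : Box (Fin 1)} {π : Prepartition I}
    (hπ : π.IsPartition) :
    ∑ J ∈ π.boxes, φ (J.lower 0) (J.upper 0) = φ (I.lower 0) (I.upper 0) := by
  let Φ : Fin 1 →ᵇᵃ M := BoxAdditiveMap.ofMapSplitAdd (fun J => φ (J.lower 0) (J.upper 0)) ⊤ <| by
    intro J _ i x hx
    obtain rfl := Subsingleton.elim i 0
    obtain ⟨hl, hu⟩ := split_intervalBox hx.1 hx.2
    rw [hl, hu]
    exact hφ _ _ _ hx.1 hx.2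
  exact Φ.sum_partition_boxes le_top hπ

/-- Lebesgue measure on the line as a box-additive map, as in `HKIntegrable`. -/
abbrev hkVol : Fin 1 →ᵇᵃ ℝ →L[ℝ] ℝ := (volume : Measure (Fin 1 → ℝ)).toBoxAdditive.toSMul

lemma hkVol_apply (J : Box (Fin 1)) (y : ℝ) : hkVol J y = (J.upper 0 - J.lower 0) * y := by
  simp [hkVol, Measure.toBoxAdditive, BoxAdditiveMap.toSMul_apply, measureReal_def,
    Box.coe_eq_pi, Real.volume_pi_Ioc_toReal, J.lower_le_upper]

/-- Henstock–Kurzweil integrability over a compact interval, given as a one-dimensional box.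
`HKIntegrable f` is `HKIntegrableOn f periodBox`. -/
abbrev HKIntegrableOn (f : ℝ → ℝ) (I : Box (Fin 1)) : Prop :=
  BoxIntegral.Integrable I IntegrationParams.Henstock (fun x : Fin 1 → ℝ => f (x 0)) hkVol

/-- The Henstock–Kurzweil integral over a compact interval, given as a one-dimensional box.
`hkIntegral f` is `hkIntegralOn f periodBox`. -/
abbrev hkIntegralOn (f : ℝ → ℝ) (I : Box (Fin 1)) : ℝ :=
  BoxIntegral.integral I IntegrationParams.Henstock (fun x : Fin 1 → ℝ => f (x 0)) hkVol

open Classical in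
/-- The indefinite Henstock–Kurzweil integral `x ↦ ∫_a^x f`, set to `0` for `x ≤ a`. -/
def hkPrimitive (f : ℝ → ℝ) (a x : ℝ) : ℝ :=
  if h : a < x then hkIntegralOn f (intervalBox a x h) else 0

lemma hkPrimitive_self (f : ℝ → ℝ) (a : ℝ) : hkPrimitive f a a = 0 := dif_neg (lt_irrefl _)

namespace HKIntegrableOn

variable {f : ℝ → ℝ} {I : Box (Fin 1)}

lemma hkIntegralOn_eq_sub (hf : HKIntegrableOn f I) {J : Box (Fin 1)} (hJ : J ≤ I) :
    hkIntegralOn f J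
      = hkPrimitive f (I.lower 0) (J.upper 0) - hkPrimitive f (I.lower 0) (J.lower 0) := by
  obtain ⟨hIJ, hJI⟩ := box_le_iff.1 hJ
  have hlu := J.lower_lt_upper 0
  have hau := hIJ.trans_lt hlu
  rw [eq_intervalBox J]
  change hkIntegralOn f (intervalBox _ _ hlu)
    = hkPrimitive f (I.lower 0) (J.upper 0) - hkPrimitive f (I.lower 0) (J.lower 0)
  rcases hIJ.eq_or_lt with h | h
  · simp [hkPrimitive, h, hlu]
  · have hle : intervalBox (I.lower 0) (J.upper 0) hau ≤ I := box_le_iff.2 ⟨le_rfl, hJI⟩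
    have hadd := (BoxIntegral.Integrable.toBoxAdditive hf).map_split_add
      (WithTop.coe_le_coe.2 hle) 0 (J.lower 0)
    obtain ⟨hl, hu⟩ := split_intervalBox (J := intervalBox _ _ hau) h hlu
    rw [hl, hu] at hadd
    change hkIntegralOn f (intervalBox _ _ h) + hkIntegralOn f (intervalBox _ _ hlu)
      = hkIntegralOn f (intervalBox _ _ hau) at hadd
    rw [hkPrimitive, hkPrimitive, dif_pos hau, dif_pos h]
    exact eq_sub_of_add_eq' hadd

lemma exists_forall_abs_hkPrimitive_sub_sub_le (hf : HKIntegrableOn f I) {ε : ℝ} (hε : 0 < ε)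
    {t : ℝ} (ht : t ∈ Icc (I.lower 0) (I.upper 0)) :
    ∃ δ > 0, ∀ x ∈ Icc (I.lower 0) (I.upper 0), |x - t| ≤ δ →
      |hkPrimitive f (I.lower 0) x - hkPrimitive f (I.lower 0) t - (x - t) * f t| ≤ ε := by
  set r := hf.convergenceR ε 0
  have key {a b : ℝ} (hab : a < b) (hI : I.lower 0 ≤ a ∧ b ≤ I.upper 0) (htab : t ∈ Icc a b)
      (hr : Icc a b ⊆ Metric.closedBall t (r fun _ => t)) :
      |(b - a) * f t - (hkPrimitive f (I.lower 0) b - hkPrimitive f (I.lower 0) a)| ≤ ε := by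
    have hle : intervalBox a b hab ≤ I := box_le_iff.2 hI
    have hmem := memBaseSet_henstock_single (c := 0) (r := r) hle
      (t := fun _ => t) (mem_Icc_box.2 htab) fun y hy => by
        rw [Metric.mem_closedBall, dist_pi_le_iff (r _).2.le]
        exact Fin.forall_fin_one.2 (hr (mem_Icc_box.1 hy))
    have h := hf.dist_integralSum_sum_integral_le_of_memBaseSet hε hmem
    change dist (∑ J ∈ {intervalBox a b hab}, hkVol J (f t))
      (∑ J ∈ {intervalBox a b hab}, hkIntegralOn f J) ≤ ε at h
    rw [Finset.sum_singleton, Finset.sum_singleton, hkVol_apply, hf.hkIntegralOn_eq_sub hle] at h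
    exact h
  refine ⟨r fun _ => t, (r _).2, fun x hx hxt => ?_⟩
  have hball : uIcc x t ⊆ Metric.closedBall t (r fun _ => t) :=
    (convex_closedBall _ _).ordConnected.uIcc_subset hxt (Metric.mem_closedBall_self (r _).2.le)
  rcases lt_trichotomy x t with h | rfl | h
  · rw [uIcc_of_le h.le] at hball
    convert key h ⟨hx.1, ht.2⟩ ⟨h.le, le_rfl⟩ hball using 2
    ring
  · simpa using hε.le
  · rw [uIcc_of_ge h.le] at hball
    rw [abs_sub_comm]
    exact key h ⟨ht.1, hx.2⟩ ⟨le_rfl, h.le⟩ hball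

lemma continuousOn_hkPrimitive (hf : HKIntegrableOn f I) :
    ContinuousOn (hkPrimitive f (I.lower 0)) (Icc (I.lower 0) (I.upper 0)) := by
  intro t ht
  have hlin : Tendsto (fun x => |(x - t) * f t|) (𝓝[Icc (I.lower 0) (I.upper 0)] t) (𝓝 0) :=
    (by fun_prop : Continuous fun x => |(x - t) * f t|).continuousWithinAt.tendsto.trans_eq
      (by simp)
  refine Metric.tendsto_nhds.2 fun ε hε => ?_
  obtain ⟨δ, hδ, h⟩ := hf.exists_forall_abs_hkPrimitive_sub_sub_le (half_pos hε) ht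
  filter_upwards [self_mem_nhdsWithin, mem_nhdsWithin_of_mem_nhds (Metric.closedBall_mem_nhds t hδ),
    hlin.eventually (gt_mem_nhds (half_pos hε))] with x hx hxδ hxε
  rw [Real.dist_eq]
  linarith [h x hx hxδ, abs_sub_abs_le_abs_sub
    (hkPrimitive f (I.lower 0) x - hkPrimitive f (I.lower 0) t) ((x - t) * f t)]

end HKIntegrableOn

end HenstockKurzweil

/-! ### Products with functions of bounded variation -/

section Products

open BoxIntegral

lemma sum_abs_le_two_mul {ι : Type*} {s : Finset ι} {d : ι → ℝ} {ε : ℝ}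
    (h : ∀ (p : ι → Prop) [DecidablePred p], |∑ i ∈ s with p i, d i| ≤ ε) :
    ∑ i ∈ s, |d i| ≤ 2 * ε := by
  classical
  have hpos : ∑ i ∈ s with 0 ≤ d i, |d i| = ∑ i ∈ s with 0 ≤ d i, d i :=
    Finset.sum_congr rfl fun i hi => abs_of_nonneg (Finset.mem_filter.1 hi).2
  have hneg : ∑ i ∈ s with ¬ 0 ≤ d i, |d i| = -∑ i ∈ s with ¬ 0 ≤ d i, d i := by
    rw [← Finset.sum_neg_distrib]
    exact Finset.sum_congr rfl fun i hi => abs_of_neg (not_le.1 (Finset.mem_filter.1 hi).2)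
  rw [← Finset.sum_filter_add_sum_filter_not s (fun i => 0 ≤ d i), hpos, hneg]
  linarith [(abs_le.1 (h fun i => 0 ≤ d i)).2, (abs_le.1 (h fun i => ¬ 0 ≤ d i)).1]

lemma abs_sub_add_abs_sub_le_eVariationOn {g : ℝ → ℝ} {l t u : ℝ} (ht : t ∈ Icc l u)
    (hg : BoundedVariationOn g (Icc l u)) :
    |g t - g u| + |g l - g t| ≤ (eVariationOn g (Icc l u)).toReal := by
  have h := add_le_add
    (eVariationOn.edist_le g (right_mem_Icc.2 ht.1) (left_mem_Icc.2 ht.1))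
    (eVariationOn.edist_le g (right_mem_Icc.2 ht.2) (left_mem_Icc.2 ht.2))
  have hadd := eVariationOn.Icc_add_Icc g (s := univ) ht.1 ht.2 (mem_univ t)
  simp only [univ_inter] at hadd
  rw [hadd, edist_dist, edist_dist, ← ENNReal.ofReal_add dist_nonneg dist_nonneg,
    ENNReal.ofReal_le_iff_le_toReal hg, Real.dist_eq, Real.dist_eq, abs_sub_comm (g t),
    add_comm] at h
  rwa [abs_sub_comm (g t)]

lemma abs_mul_add_mul_le_mul_eVariationOn {F g : ℝ → ℝ} {l t u η : ℝ} (ht : t ∈ Icc l u)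
    (hl : |F l| ≤ η) (hu : |F u| ≤ η) (hg : BoundedVariationOn g (Icc l u)) :
    |(g t - g u) * F u + (g l - g t) * F l| ≤ η * (eVariationOn g (Icc l u)).toReal := by
  have hη : 0 ≤ η := (abs_nonneg _).trans hl
  calc _ ≤ |g t - g u| * |F u| + |g l - g t| * |F l| := by
        simpa only [abs_mul] using abs_add_le ((g t - g u) * F u) ((g l - g t) * F l)
    _ ≤ |g t - g u| * η + |g l - g t| * η := by gcongr
    _ = η * (|g t - g u| + |g l - g t|) := by ring
    _ ≤ _ := by
        gcongr
        exact abs_sub_add_abs_sub_le_eVariationOn ht hg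

lemma sum_boxes_eVariationOn (g : ℝ → ℝ) {I : Box (Fin 1)} {π : Prepartition I}
    (hπ : π.IsPartition) : ∑ J ∈ π.boxes, eVariationOn g (Icc (J.lower 0) (J.upper 0))
      = eVariationOn g (Icc (I.lower 0) (I.upper 0)) :=
  sum_boxes_eq_of_additive (φ := fun a b => eVariationOn g (Icc a b)) (fun a b c hab hbc => by
    simpa only [univ_inter] using eVariationOn.Icc_add_Icc g hab.le hbc.le (mem_univ b)) hπ

lemma sum_boxes_mul_sub_eq_summation_by_parts (F g : ℝ → ℝ) {I : Box (Fin 1)}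
    {π : TaggedPrepartition I} (hπ : π.IsPartition) :
    ∑ J ∈ π.boxes, g (π.tag J 0) * (F (J.upper 0) - F (J.lower 0))
      = g (I.upper 0) * F (I.upper 0) - g (I.lower 0) * F (I.lower 0)
        + ∑ J ∈ π.boxes, ((g (π.tag J 0) - g (J.upper 0)) * F (J.upper 0)
          + (g (J.lower 0) - g (π.tag J 0)) * F (J.lower 0)) := by
  rw [← sum_boxes_eq_of_additive (φ := fun a b => g b * F b - g a * F a)
    (fun _ _ _ _ _ => by ring) hπ, ← Finset.sum_add_distrib]
  exact Finset.sum_congr rfl fun J _ => by ring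

lemma abs_sum_mul_sub_le {F g : ℝ → ℝ} {I : Box (Fin 1)} {π : TaggedPrepartition I}
    (hπ : π.IsPartition) (hH : π.IsHenstock) (hF : F (I.lower 0) = 0) {η : ℝ}
    (hη : ∀ x ∈ Icc (I.lower 0) (I.upper 0), |F x| ≤ η)
    (hg : BoundedVariationOn g (Icc (I.lower 0) (I.upper 0))) :
    |∑ J ∈ π.boxes, g (π.tag J 0) * (F (J.upper 0) - F (J.lower 0))|
      ≤ η * (|g (I.upper 0)| + (eVariationOn g (Icc (I.lower 0) (I.upper 0))).toReal) := by
  have hI {J} (hJ : J ∈ π.boxes) : Icc (J.lower 0) (J.upper 0) ⊆ Icc (I.lower 0) (I.upper 0) :=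
    have h := box_le_iff.1 (π.le_of_mem hJ)
    Icc_subset_Icc h.1 h.2
  have hV {J} (hJ : J ∈ π.boxes) := hg.mono (hI hJ)
  have hbox {J} (hJ : J ∈ π.boxes) :
      |(g (π.tag J 0) - g (J.upper 0)) * F (J.upper 0)
        + (g (J.lower 0) - g (π.tag J 0)) * F (J.lower 0)|
        ≤ η * (eVariationOn g (Icc (J.lower 0) (J.upper 0))).toReal :=
    have hlu := J.lower_le_upper 0
    abs_mul_add_mul_le_mul_eVariationOn (mem_Icc_box.1 (hH J hJ))
      (hη _ (hI hJ (left_mem_Icc.2 hlu))) (hη _ (hI hJ (right_mem_Icc.2 hlu))) (hV hJ)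
  rw [sum_boxes_mul_sub_eq_summation_by_parts F g hπ, hF, mul_zero, sub_zero, mul_add,
    ← sum_boxes_eVariationOn g hπ, ENNReal.toReal_sum fun J hJ => hV hJ, Finset.mul_sum]
  refine (abs_add_le _ _).trans (add_le_add ?_ ((Finset.abs_sum_le_sum_abs _ _).trans
    (Finset.sum_le_sum fun J hJ => hbox hJ)))
  rw [abs_mul, mul_comm]
  gcongr
  exact hη _ (right_mem_Icc.2 (I.lower_le_upper 0))

lemma abs_le_add_eVariationOn {g : ℝ → ℝ} {s : Set ℝ} (hg : BoundedVariationOn g s) {x y : ℝ}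
    (hx : x ∈ s) (hy : y ∈ s) : |g x| ≤ |g y| + (eVariationOn g s).toReal := by
  have h := hg.dist_le hx hy
  rw [Real.dist_eq] at h
  linarith [abs_sub_abs_le_abs_sub (g x) (g y)]

namespace HKIntegrableOn

variable {f g : ℝ → ℝ} {I : Box (Fin 1)}

lemma saksHenstock_sum_abs_sub_le (hf : HKIntegrableOn f I) {ε : ℝ} (hε : 0 < ε) {c : NNReal}
    {π : TaggedPrepartition I}
    (hπ : IntegrationParams.Henstock.MemBaseSet I c (hf.convergenceR ε c) π) :
    ∑ J ∈ π.boxes, |(J.upper 0 - J.lower 0) * f (π.tag J 0)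
      - (hkPrimitive f (I.lower 0) (J.upper 0) - hkPrimitive f (I.lower 0) (J.lower 0))|
      ≤ 2 * ε := by
  refine sum_abs_le_two_mul fun p _ => ?_
  have h := hf.dist_integralSum_sum_integral_le_of_memBaseSet hε (hπ.filter p)
  have hboxes : (π.filter p).boxes = π.boxes.filter p := by
    ext J
    exact π.mem_filter.trans (by simp)
  rw [integralSum, Real.dist_eq, hboxes, ← Finset.sum_sub_distrib] at h
  convert h using 2
  refine Finset.sum_congr rfl fun J hJ => ?_
  rw [hkVol_apply, ← hf.hkIntegralOn_eq_sub (π.le_of_mem (Finset.mem_filter.1 hJ).1)]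
  rfl

lemma abs_sum_mul_error_le (hf : HKIntegrableOn f I) {M : ℝ}
    (hM : ∀ x ∈ Icc (I.lower 0) (I.upper 0), |g x| ≤ M) {ε : ℝ} (hε : 0 < ε) {c : NNReal}
    {π : TaggedPrepartition I}
    (hπ : IntegrationParams.Henstock.MemBaseSet I c (hf.convergenceR ε c) π) :
    |∑ J ∈ π.boxes, g (π.tag J 0) * ((J.upper 0 - J.lower 0) * f (π.tag J 0)
      - (hkPrimitive f (I.lower 0) (J.upper 0) - hkPrimitive f (I.lower 0) (J.lower 0)))|
      ≤ M * (2 * ε) := by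
  have hM0 : 0 ≤ M := (abs_nonneg _).trans (hM _ (left_mem_Icc.2 (I.lower_le_upper 0)))
  refine le_trans ?_ (mul_le_mul_of_nonneg_left (hf.saksHenstock_sum_abs_sub_le hε hπ) hM0)
  rw [Finset.mul_sum]
  refine (Finset.abs_sum_le_sum_abs _ _).trans (Finset.sum_le_sum fun J _ => ?_)
  rw [abs_mul]
  gcongr
  exact hM _ (mem_Icc_box.1 (π.tag_mem_Icc J))

lemma eventually_abs_integralSum_mul_le (hf : HKIntegrableOn f I) {η : ℝ}
    (hη : ∀ x ∈ Icc (I.lower 0) (I.upper 0), |hkPrimitive f (I.lower 0) x| ≤ η)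
    (hg : BoundedVariationOn g (Icc (I.lower 0) (I.upper 0))) {ε : ℝ} (hε : 0 < ε) :
    ∀ᶠ π in IntegrationParams.Henstock.toFilteriUnion I ⊤,
      |integralSum (fun x : Fin 1 → ℝ => f (x 0) * g (x 0)) hkVol π|
        ≤ η * (|g (I.upper 0)| + (eVariationOn g (Icc (I.lower 0) (I.upper 0))).toReal) + ε := by
  set F := hkPrimitive f (I.lower 0)
  set M := |g (I.upper 0)| + (eVariationOn g (Icc (I.lower 0) (I.upper 0))).toReal
  have hM0 : 0 ≤ M := by positivity
  have hgM (x) (hx : x ∈ Icc (I.lower 0) (I.upper 0)) : |g x| ≤ M :=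
    abs_le_add_eVariationOn hg hx (right_mem_Icc.2 (I.lower_le_upper 0))
  set ε' := ε / (2 * (M + 1))
  have hε' : 0 < ε' := by positivity
  have hMε : M * (2 * ε') ≤ ε := calc
    _ ≤ (M + 1) * (2 * ε') := by gcongr; linarith
    _ = ε := by simp only [ε']; field_simp
  refine (IntegrationParams.Henstock.hasBasis_toFilteriUnion_top I).mem_iff.2
    ⟨hf.convergenceR ε', hf.convergenceR_cond ε', ?_⟩
  rintro π ⟨c, hmem, hpart⟩
  have hsplit : integralSum (fun x : Fin 1 → ℝ => f (x 0) * g (x 0)) hkVol π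
      = ∑ J ∈ π.boxes, g (π.tag J 0) * (F (J.upper 0) - F (J.lower 0))
        + ∑ J ∈ π.boxes, g (π.tag J 0) * ((J.upper 0 - J.lower 0) * f (π.tag J 0)
          - (F (J.upper 0) - F (J.lower 0))) := by
    rw [integralSum, ← Finset.sum_add_distrib]
    refine Finset.sum_congr rfl fun J _ => ?_
    rw [hkVol_apply]
    ring
  rw [mem_ofPred_eq, hsplit]
  exact (abs_add_le _ _).trans (add_le_add
    (abs_sum_mul_sub_le hpart (hmem.isHenstock rfl) (hkPrimitive_self f _) hη hg)
    ((hf.abs_sum_mul_error_le hgM hε' hmem).trans hMε))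

end HKIntegrableOn

lemma intervalIntegrable_continuous_mul {p g : ℝ → ℝ} {a b : ℝ} (hp : Continuous p)
    (hg : BoundedVariationOn g (Icc a b)) (hab : a ≤ b) :
    IntervalIntegrable (fun x => p x * g x) volume a b :=
  (intervalIntegrable_of_boundedVariationOn (by rwa [uIcc_of_le hab])).continuousOn_mul
    hp.continuousOn

lemma hasIntegral_of_intervalIntegrable {q : ℝ → ℝ} {J : Box (Fin 1)}
    (hq : IntervalIntegrable q volume (J.lower 0) (J.upper 0)) :
    HasIntegral J IntegrationParams.Henstock (fun x : Fin 1 → ℝ => q (x 0)) hkVol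
      (∫ x in (J.lower 0)..(J.upper 0), q x) := by
  have hle := J.lower_le_upper 0
  have hmp := volume_preserving_funUnique (Fin 1) ℝ
  have hJ : (J : Set (Fin 1 → ℝ))
      = MeasurableEquiv.funUnique (Fin 1) ℝ ⁻¹' Ioc (J.lower 0) (J.upper 0) := by
    ext x
    simp [Box.mem_def]
  have hint : IntegrableOn (fun x : Fin 1 → ℝ => q (x 0)) J volume := by
    rw [hJ]
    exact (hmp.integrableOn_comp_preimage (MeasurableEquiv.measurableEmbedding _)).2
      ((intervalIntegrable_iff_integrableOn_Ioc_of_le hle).1 hq)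
  rw [intervalIntegral.integral_of_le hle,
    ← hmp.setIntegral_preimage_emb (MeasurableEquiv.measurableEmbedding _), ← hJ]
  exact hint.hasBoxIntegral IntegrationParams.Henstock rfl

namespace HKIntegrableOn

variable {f g : ℝ → ℝ} {I : Box (Fin 1)}

lemma hkPrimitive_sub_continuous (hf : HKIntegrableOn f I) {p : ℝ → ℝ} (hp : Continuous p) {x : ℝ}
    (hx : x ∈ Icc (I.lower 0) (I.upper 0)) :
    hkPrimitive (f - p) (I.lower 0) x
      = hkPrimitive f (I.lower 0) x - ∫ y in (I.lower 0)..x, p y := by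
  rcases hx.1.eq_or_lt with rfl | h
  · simp [hkPrimitive_self]
  · have hle : intervalBox (I.lower 0) x h ≤ I := box_le_iff.2 ⟨le_rfl, hx.2⟩
    have hp' := hasIntegral_of_intervalIntegrable (J := intervalBox (I.lower 0) x h)
      (hp.intervalIntegrable _ _)
    rw [hkPrimitive, hkPrimitive, dif_pos h, dif_pos h]
    exact ((hf.to_subbox hle).hasIntegral.sub hp').integral_eq

lemma sub_continuous (hf : HKIntegrableOn f I) {p : ℝ → ℝ} (hp : Continuous p) :
    HKIntegrableOn (f - p) I :=
  BoxIntegral.Integrable.sub hf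
    (hasIntegral_of_intervalIntegrable (hp.intervalIntegrable _ _)).integrable

-- Density of the continuous functions in the Alexiewicz norm `sup |∫_a^x f|`: differentiate a
-- polynomial which is uniformly close to the primitive.
lemma exists_continuous_forall_abs_hkPrimitive_sub_le (hf : HKIntegrableOn f I) {ε : ℝ}
    (hε : 0 < ε) :
    ∃ p : ℝ → ℝ, Continuous p ∧
      ∀ x ∈ Icc (I.lower 0) (I.upper 0), |hkPrimitive (f - p) (I.lower 0) x| ≤ ε := by
  obtain ⟨P, hP⟩ := exists_polynomial_near_of_continuousOn _ _ _ hf.continuousOn_hkPrimitive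
    (ε / 2) (by positivity)
  have hp : Continuous fun x => P.derivative.eval x := P.derivative.continuous
  refine ⟨_, hp, fun x hx => ?_⟩
  rw [hf.hkPrimitive_sub_continuous hp hx, intervalIntegral.integral_eq_sub_of_hasDerivAt
    (fun y _ => P.hasDerivAt y) (hp.intervalIntegrable _ _)]
  have hx' := abs_lt.1 (hP x hx)
  have ha := abs_lt.1 (hP _ (left_mem_Icc.2 (I.lower_le_upper 0)))
  rw [hkPrimitive_self] at ha
  rw [abs_le]
  constructor <;> linarith

lemma mul (hf : HKIntegrableOn f I)
    (hg : BoundedVariationOn g (Icc (I.lower 0) (I.upper 0))) :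
    HKIntegrableOn (fun x => f x * g x) I := by
  refine integrable_of_forall_eventually_dist_integralSum_le fun ε hε => ?_
  set M := |g (I.upper 0)| + (eVariationOn g (Icc (I.lower 0) (I.upper 0))).toReal
  have hM0 : 0 ≤ M := by positivity
  set η := ε / (M + 1)
  have hη : 0 < η := by positivity
  obtain ⟨p, hp, hfp⟩ := hf.exists_continuous_forall_abs_hkPrimitive_sub_le hη
  refine ⟨fun x => p (x 0) * g (x 0), (hasIntegral_of_intervalIntegrable
    (intervalIntegrable_continuous_mul hp hg (I.lower_le_upper 0))).integrable, ?_⟩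
  filter_upwards [(hf.sub_continuous hp).eventually_abs_integralSum_mul_le hfp hg hη] with π hπ
  rw [Real.dist_eq, ← integralSum_sub]
  calc _ ≤ η * M + η := by
        convert hπ using 3
        funext x
        exact (sub_mul _ _ _).symm
    _ = ε := by simp only [η]; field_simp

lemma abs_hkIntegralOn_mul_le (hf : HKIntegrableOn f I) {η : ℝ}
    (hη : ∀ x ∈ Icc (I.lower 0) (I.upper 0), |hkPrimitive f (I.lower 0) x| ≤ η)
    (hg : BoundedVariationOn g (Icc (I.lower 0) (I.upper 0))) :
    |hkIntegralOn (fun x => f x * g x) I|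
      ≤ η * (|g (I.upper 0)| + (eVariationOn g (Icc (I.lower 0) (I.upper 0))).toReal) :=
  le_of_forall_pos_le_add fun _ hε => le_of_tendsto (hf.mul hg).hasIntegral.tendsto.abs
    (hf.eventually_abs_integralSum_mul_le hη hg hε)

lemma hkIntegralOn_mul_sub (hf : HKIntegrableOn f I) {p : ℝ → ℝ} (hp : Continuous p)
    (hg : BoundedVariationOn g (Icc (I.lower 0) (I.upper 0))) :
    hkIntegralOn (fun x => (f - p) x * g x) I
      = hkIntegralOn (fun x => f x * g x) I - ∫ x in (I.lower 0)..(I.upper 0), p x * g x := by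
  have hpg := hasIntegral_of_intervalIntegrable
    (intervalIntegrable_continuous_mul hp hg (I.lower_le_upper 0))
  convert ((hf.mul hg).hasIntegral.sub hpg).integral_eq using 2
  funext x
  exact sub_mul _ _ _

end HKIntegrableOn

-- The bound through the primitive is uniform on bounded sets of `BV`, so that it suffices to test
-- against the dense set of continuous functions.
lemma tendsto_hkIntegralOn_mul {ι : Type*} {l : Filter ι} {f g : ℝ → ℝ} {G : ι → ℝ → ℝ}
    {I : Box (Fin 1)} (hf : HKIntegrableOn f I) {V : NNReal} {M : ℝ}
    (hg : eVariationOn g (Icc (I.lower 0) (I.upper 0)) ≤ V)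
    (hgM : |g (I.upper 0)| ≤ M)
    (hG : ∀ᶠ i in l, eVariationOn (G i) (Icc (I.lower 0) (I.upper 0)) ≤ V)
    (hGM : ∀ᶠ i in l, |G i (I.upper 0)| ≤ M)
    (h : ∀ p : ℝ → ℝ, Continuous p →
      Tendsto (fun i => ∫ x in (I.lower 0)..(I.upper 0), p x * G i x) l
        (𝓝 (∫ x in (I.lower 0)..(I.upper 0), p x * g x))) :
    Tendsto (fun i => hkIntegralOn (fun x => f x * G i x) I) l
      (𝓝 (hkIntegralOn (fun x => f x * g x) I)) := by
  have hM : 0 ≤ M := (abs_nonneg _).trans hgM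
  refine Metric.tendsto_nhds.2 fun ε hε => ?_
  set η := ε / (3 * (M + V + 1))
  have hη : 0 < η := by positivity
  obtain ⟨p, hp, hfp⟩ := hf.exists_continuous_forall_abs_hkPrimitive_sub_le hη
  have hbound {k : ℝ → ℝ}
      (hk : eVariationOn k (Icc (I.lower 0) (I.upper 0)) ≤ V)
      (hkM : |k (I.upper 0)| ≤ M) : |hkIntegralOn (fun x => f x * k x) I
        - ∫ x in (I.lower 0)..(I.upper 0), p x * k x| ≤ ε / 3 := by
    have hk' := ne_top_of_le_ne_top ENNReal.coe_ne_top hk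
    rw [← hf.hkIntegralOn_mul_sub hp hk']
    calc _ ≤ η * (M + V) := by
          refine ((hf.sub_continuous hp).abs_hkIntegralOn_mul_le hfp hk').trans ?_
          gcongr
          exact (ENNReal.toReal_mono ENNReal.coe_ne_top hk)
      _ ≤ η * (M + V + 1) := mul_le_mul_of_nonneg_left (by linarith) hη.le
      _ = ε / 3 := by simp only [η]; field_simp
  filter_upwards [hG, hGM, Metric.tendsto_nhds.1 (h p hp) (ε / 3) (by positivity)]
    with i hGi hGMi hi
  have hi' := abs_le.1 (hbound hGi hGMi)
  have hg' := abs_le.1 (hbound hg hgM)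
  rw [Real.dist_eq, abs_lt] at hi ⊢
  constructor <;> linarith

end Products

lemma isBV_slice_poissonIntegral {g : ℝ → ℝ} (hg : IsBV g) {r : ℝ} (hr : r ∈ Ico (0 : ℝ) 1) :
    IsBV (slice (poissonIntegral g) r) :=
  ⟨periodic_slice _ _,
    (variation_slice_poissonIntegral_le hg.1 (hg.intervalIntegrable _ _) hr).trans_lt hg.2⟩

lemma tendsto_integral_mul_slice_poissonIntegral {p g : ℝ → ℝ} (hp : Continuous p) (hg : IsBV g)
    (a b : ℝ) :
    Tendsto (fun r => ∫ x in a..b, p x * slice (poissonIntegral g) r x) (𝓝[<] 1)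
      (𝓝 (∫ x in a..b, p x * g x)) := by
  refine intervalIntegral.tendsto_integral_filter_of_dominated_convergence
    (fun x => |p x| * (|g 0| + (variation g).toReal)) ?_ ?_ ?_ ?_
  · filter_upwards [eventually_mem_Ico_zero_one] with r hr
    exact (((isBV_slice_poissonIntegral hg hr).intervalIntegrable _ _).continuousOn_mul
      hp.continuousOn).aestronglyMeasurable_restrict_uIoc
  · filter_upwards [eventually_mem_Ico_zero_one] with r hr
    refine Eventually.of_forall fun x _ => ?_
    rw [norm_mul, Real.norm_eq_abs, Real.norm_eq_abs]
    gcongr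
    exact abs_slice_poissonIntegral_le hg.1 (fun x => hg.abs_le x 0) hr x
  · exact (hp.abs.mul continuous_const).intervalIntegrable _ _
  · filter_upwards [hg.countable_not_continuousAt.ae_notMem volume] with x hx _
    exact (tendsto_slice_poissonIntegral hg.1 (hg.intervalIntegrable _ _)
      (not_not.1 hx)).const_mul (p x)

lemma tendsto_hkIntegral_mul_slice_poissonIntegral {f g : ℝ → ℝ} (hf : HKIntegrable f)
    (hg : IsBV g) :
    Tendsto (fun r => hkIntegral fun θ => f θ * slice (poissonIntegral g) r θ) (𝓝[<] 1)
      (𝓝 (hkIntegral fun θ => f θ * g θ)) := by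
  have hV : variation g = (variation g).toNNReal := (ENNReal.coe_toNNReal hg.2.ne).symm
  refine tendsto_hkIntegralOn_mul (I := periodBox) hf (M := |g 0| + (variation g).toReal)
    hV.le (hg.abs_le _ 0) ?_ ?_ fun p hp => tendsto_integral_mul_slice_poissonIntegral hp hg _ _
  · filter_upwards [eventually_mem_Ico_zero_one] with r hr
    exact (variation_slice_poissonIntegral_le hg.1 (hg.intervalIntegrable _ _) hr).trans_eq hV
  · filter_upwards [eventually_mem_Ico_zero_one] with r hr
    exact abs_slice_poissonIntegral_le hg.1 (fun x => hg.abs_le x 0) hr _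

/-! ### Failure of convergence in variation -/

lemma IsHarmonicOnDisc.continuous_slice {u : Disc → ℝ} (hu : IsHarmonicOnDisc u) {r : ℝ}
    (hr : r ∈ Ico (0 : ℝ) 1) : Continuous (slice u r) :=
  continuous_iff_continuousAt.2 fun θ =>
    ContinuousAt.comp (f := circleMap 0 r) (hu _ (circleMap_mem_ball hr θ)).1.continuousAt
      (continuous_circleMap 0 r).continuousAt

-- `P[s]_r` is continuous, so that `P[s]_r - s` has the jumps of `-s`, whose size is at most the
-- variation.
lemma not_tendsto_variation_slice_sub {s : ℝ → ℝ} (hs : IsBV s) {x a b : ℝ}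
    (ha : Tendsto s (𝓝[>] x) (𝓝 a)) (hb : Tendsto s (𝓝[<] x) (𝓝 b)) (hab : a ≠ b) :
    ¬ Tendsto (fun r => variation (slice (poissonIntegral s) r - s)) (𝓝[<] 1) (𝓝 0) := by
  intro h
  obtain ⟨r, hlt, hr⟩ :=
    ((h.eventually_lt_const (edist_pos.2 hab)).and eventually_mem_Ico_zero_one).exists
  have hw := ((isHarmonicOnDisc_poissonIntegral hs.1
    (hs.intervalIntegrable _ _)).continuous_slice hr).tendsto x
  have hjump := edist_le_variation_of_tendsto ((periodic_slice _ _).sub hs.1)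
    ((hw.mono_left nhdsWithin_le_nhds).sub ha) ((hw.mono_left nhdsWithin_le_nhds).sub hb)
  rw [edist_sub_left] at hjump
  exact hlt.not_ge hjump

lemma variation_sub_le (f g : ℝ → ℝ) : variation (f - g) ≤ variation f + variation g := by
  simpa only [sub_eq_add_neg, variation_neg] using variation_add_le f (-g)

lemma variation_lt_top_of_monotone {f : ℝ → ℝ} (hf : Monotone f) : variation f < ∞ := by
  rw [variation, ← univ_inter (Icc _ _),
    (hf.monotoneOn univ).eVariationOn_eq (mem_univ _) (mem_univ _)]
  exact ENNReal.ofReal_lt_top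

/-- The phase `(θ + π) / (2π)`, which maps the period `[-π, π)` onto `[0, 1)`. -/
def phase (θ : ℝ) : ℝ := (θ + Real.pi) / (2 * Real.pi)

lemma continuous_phase : Continuous phase := by
  unfold phase
  fun_prop

lemma strictMono_phase : StrictMono phase := fun _ _ h =>
  div_lt_div_of_pos_right (add_lt_add_left h _) Real.two_pi_pos

lemma phase_neg_pi : phase (-Real.pi) = 0 := by simp [phase]

lemma phase_add_two_pi (θ : ℝ) : phase (θ + 2 * Real.pi) = phase θ + 1 := by
  rw [phase, add_right_comm, add_div, div_self Real.two_pi_pos.ne', phase]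

/-- The sawtooth wave `x - m x` in the variable `x = phase θ`. The step function `m` (such as the
floor) fixes the values at the jumps. -/
def sawtooth (m : ℝ → ℝ) (θ : ℝ) : ℝ := phase θ - m (phase θ)

lemma isBV_sawtooth {m : ℝ → ℝ} (hm : Monotone m) (hm1 : ∀ x, m (x + 1) = m x + 1) :
    IsBV (sawtooth m) := by
  refine ⟨fun θ => ?_, (variation_sub_le phase (m ∘ phase)).trans_lt <| ENNReal.add_lt_top.2
    ⟨variation_lt_top_of_monotone strictMono_phase.monotone,
      variation_lt_top_of_monotone (hm.comp strictMono_phase.monotone)⟩⟩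
  simp only [sawtooth, phase_add_two_pi, hm1, add_sub_add_right_eq_sub]

lemma tendsto_sawtooth_nhdsGT {m : ℝ → ℝ} {θ a : ℝ} (hm : Tendsto m (𝓝[>] phase θ) (𝓝 a)) :
    Tendsto (sawtooth m) (𝓝[>] θ) (𝓝 (phase θ - a)) :=
  continuous_phase.continuousWithinAt.tendsto.sub <| hm.comp <|
    continuous_phase.continuousWithinAt.tendsto_nhdsWithin strictMono_phase.mapsTo_Ioi

lemma tendsto_sawtooth_nhdsLT {m : ℝ → ℝ} {θ a : ℝ} (hm : Tendsto m (𝓝[<] phase θ) (𝓝 a)) :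
    Tendsto (sawtooth m) (𝓝[<] θ) (𝓝 (phase θ - a)) :=
  continuous_phase.continuousWithinAt.tendsto.sub <| hm.comp <|
    continuous_phase.continuousWithinAt.tendsto_nhdsWithin strictMono_phase.mapsTo_Iio

lemma tendsto_floor_nhdsGT (x : ℝ) :
    Tendsto (fun x : ℝ => (⌊x⌋ : ℝ)) (𝓝[>] x) (𝓝 (⌊x⌋ : ℝ)) :=
  (tendsto_pure_nhds (fun n : ℤ => (n : ℝ)) ⌊x⌋).comp
    ((tendsto_floor_right_pure_floor x).mono_left (nhdsWithin_mono _ Ioi_subset_Ici_self))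

lemma tendsto_floor_nhdsLT (x : ℝ) :
    Tendsto (fun x : ℝ => (⌊x⌋ : ℝ)) (𝓝[<] x) (𝓝 ((⌈x⌉ - 1 : ℤ) : ℝ)) :=
  (tendsto_pure_nhds (fun n : ℤ => (n : ℝ)) _).comp (tendsto_floor_left_pure_ceil_sub_one x)

lemma tendsto_ceil_nhdsLT (x : ℝ) :
    Tendsto (fun x : ℝ => (⌈x⌉ : ℝ)) (𝓝[<] x) (𝓝 (⌈x⌉ : ℝ)) :=
  (tendsto_pure_nhds (fun n : ℤ => (n : ℝ)) ⌈x⌉).comp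
    ((tendsto_ceil_left_pure_ceil x).mono_left (nhdsWithin_mono _ Iio_subset_Iic_self))

lemma tendsto_ceil_nhdsGT (x : ℝ) :
    Tendsto (fun x : ℝ => (⌈x⌉ : ℝ)) (𝓝[>] x) (𝓝 ((⌊x⌋ + 1 : ℤ) : ℝ)) :=
  (tendsto_pure_nhds (fun n : ℤ => (n : ℝ)) _).comp (tendsto_ceil_right_pure_floor_add_one x)

lemma exists_nbv_not_tendsto_variation : ∃ σ ∈ nbv,
    ¬ Tendsto (fun r => variation (slice (poissonIntegral σ) r - σ)) (𝓝[<] 1) (𝓝 0) := by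
  have hbv : IsBV (sawtooth fun x => ⌊x⌋) :=
    isBV_sawtooth (Int.cast_mono.comp Int.floor_mono) fun x => by simp
  have hright (θ : ℝ) := tendsto_sawtooth_nhdsGT (tendsto_floor_nhdsGT (phase θ))
  have hleft (θ : ℝ) := tendsto_sawtooth_nhdsLT (tendsto_floor_nhdsLT (phase θ))
  refine ⟨_, ⟨hbv, ?_, fun θ => continuousWithinAt_Ioi_iff_Ici.1 (hright θ)⟩,
    not_tendsto_variation_slice_sub hbv (hright (-Real.pi)) (hleft (-Real.pi)) ?_⟩
  · simp [sawtooth, phase_neg_pi]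
  · norm_num [phase_neg_pi]

lemma exists_mean_not_tendsto_variation : ∃ τ : ℝ → ℝ, IsBV τ ∧
    (∀ θ : ℝ, ∃ l₁ l₂ : ℝ, Tendsto τ (𝓝[>] θ) (𝓝 l₁) ∧ Tendsto τ (𝓝[<] θ) (𝓝 l₂) ∧
      τ θ = (l₁ + l₂) / 2) ∧
    ¬ Tendsto (fun r => variation (slice (poissonIntegral τ) r - τ)) (𝓝[<] 1) (𝓝 0) := by
  have hmono : Monotone fun x : ℝ => ((⌊x⌋ : ℝ) + ⌈x⌉) / 2 := fun x y h => by
    dsimp only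
    gcongr
  have hbv : IsBV (sawtooth fun x => (⌊x⌋ + ⌈x⌉) / 2) := isBV_sawtooth hmono fun x => by
    push_cast [Int.floor_add_one, Int.ceil_add_one]
    ring
  have hright (θ : ℝ) := tendsto_sawtooth_nhdsGT
    (((tendsto_floor_nhdsGT (phase θ)).add (tendsto_ceil_nhdsGT (phase θ))).div_const 2)
  have hleft (θ : ℝ) := tendsto_sawtooth_nhdsLT
    (((tendsto_floor_nhdsLT (phase θ)).add (tendsto_ceil_nhdsLT (phase θ))).div_const 2)
  refine ⟨_, hbv, fun θ => ⟨_, _, hright θ, hleft θ, ?_⟩,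
    not_tendsto_variation_slice_sub hbv (hright (-Real.pi)) (hleft (-Real.pi)) ?_⟩
  · push_cast [sawtooth]
    ring
  · norm_num [phase_neg_pi]

/-! ### The null space of the seminorm of `h^BV` -/

lemma variation_slice_le_hardyVariation (u : Disc → ℝ) {r : ℝ} (hr : r ∈ Ico (0 : ℝ) 1) :
    variation (slice u r) ≤ hardyVariation u :=
  le_iSup₂ (f := fun r (_ : r ∈ Ico (0 : ℝ) 1) => variation (slice u r)) r hr

lemma norm_mem_Ico (z : Disc) : ‖(z : ℂ)‖ ∈ Ico (0 : ℝ) 1 :=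
  ⟨norm_nonneg _, mem_ball_zero_iff.1 z.2⟩

lemma slice_norm_arg (u : Disc → ℝ) (z : Disc) : slice u ‖(z : ℂ)‖ (Complex.arg z) = u z := by
  rw [slice, circleMap_norm_arg]
  exact dif_pos z.2

lemma IsHarmonicOnDisc.exists_slice_eq_extendZero_zero {u : Disc → ℝ} (hu : IsHarmonicOnDisc u)
    {r : ℝ} (hr : r ∈ Ico (0 : ℝ) 1) : ∃ θ, slice u r θ = extendZero u 0 := by
  obtain ⟨θ, -, hθ⟩ := exists_eq_interval_average Real.two_pi_pos.ne
    (hu.continuous_slice hr).continuousOn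
  refine ⟨θ, hθ.trans ?_⟩
  rw [← InnerProductSpace.HarmonicOnNhd.circleAverage_eq (c := 0) (R := r) (HarmonicOnNhd.mono hu
    (Metric.closedBall_subset_ball ((abs_of_nonneg hr.1).trans_lt hr.2))),
    Real.circleAverage_eq_intervalAverage]
  rfl

lemma IsHarmonicOnDisc.edist_slice_extendZero_zero_le {u : Disc → ℝ} (hu : IsHarmonicOnDisc u)
    {r : ℝ} (hr : r ∈ Ico (0 : ℝ) 1) (θ : ℝ) :
    edist (slice u r θ) (extendZero u 0) ≤ hardyVariation u := by
  obtain ⟨φ, hφ⟩ := hu.exists_slice_eq_extendZero_zero hr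
  rw [← hφ]
  exact (edist_le_variation (periodic_slice u r) θ φ).trans (variation_slice_le_hardyVariation u hr)

lemma IsHarmonicOnDisc.hardyVariation_eq_zero_iff {u : Disc → ℝ} (hu : IsHarmonicOnDisc u) :
    hardyVariation u = 0 ↔ ∃ c : ℝ, ∀ z, u z = c := by
  constructor
  · intro h
    refine ⟨extendZero u 0, fun z => edist_le_zero.1 ?_⟩
    rw [← h, ← slice_norm_arg u z]
    exact hu.edist_slice_extendZero_zero_le (norm_mem_Ico z) _
  · rintro ⟨c, hc⟩
    refine nonpos_iff_eq_zero.1 (iSup₂_le fun r hr => ?_)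
    have hslice : slice u r = fun _ => c := funext fun θ => by rw [slice_eq hr, hc]
    rw [hslice, variation_const]

lemma HBV.norm_def (u : HBV) : ‖u‖ = (hardyVariation u.toFun).toReal := rfl

lemma HBV.norm_eq_zero_iff (u : HBV) : ‖u‖ = 0 ↔ ∃ c : ℝ, ∀ z : Disc, u.toFun z = c := by
  have hu : u.toFun ∈ hbv := u.2
  rw [HBV.norm_def, ENNReal.toReal_eq_zero_iff, or_iff_left hu.2.ne,
    IsHarmonicOnDisc.hardyVariation_eq_zero_iff hu.1]

/-! ### Completeness of `NBV` -/

lemma mem_nbv_of_tendstoUniformly {ι : Type*} {l : Filter ι} [l.NeBot] {F : ι → ℝ → ℝ} {G : ℝ → ℝ}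
    (hF : ∀ i, F i ∈ nbv) {V : ℝ≥0∞} (hV : V < ∞) (hFV : ∀ᶠ i in l, variation (F i) ≤ V)
    (hFG : TendstoUniformly F G l) : G ∈ nbv := by
  have hlim := hFG.tendsto_at
  refine ⟨⟨fun x => ?_, ?_⟩, ?_, fun x => ?_⟩
  · exact tendsto_nhds_unique (hlim _) ((hlim x).congr fun i => ((hF i).1.1 x).symm)
  · exact (eVariationOn_le_of_tendsto (fun x _ => hlim x) hFV).trans_lt hV
  · exact tendsto_nhds_unique (hlim _) (tendsto_const_nhds.congr fun i => ((hF i).2.1).symm)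
  · exact hFG.tendsto_of_eventually_tendsto (Eventually.of_forall fun i => (hF i).2.2 x) (hlim x)

namespace NBV

/-- The element of `NBV` given by a function in `nbv`. -/
def mk (g : ℝ → ℝ) (hg : g ∈ nbv) : NBV := (⟨g, hg⟩ : nbv)

lemma mem (g : NBV) : g.toFun ∈ nbv := g.2

lemma norm_def (g : NBV) : ‖g‖ = (variation g.toFun).toReal := rfl

lemma variation_le_ofReal_iff {g : NBV} {ε : ℝ} (hε : 0 ≤ ε) :
    variation g.toFun ≤ ENNReal.ofReal ε ↔ ‖g‖ ≤ ε :=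
  ENNReal.le_ofReal_iff_toReal_le g.mem.1.2.ne hε

lemma abs_le_norm (g : NBV) (x : ℝ) : |g.toFun x| ≤ ‖g‖ := by
  simpa [g.mem.2.1, norm_def] using g.mem.1.abs_le x (-Real.pi)

lemma exists_tendstoUniformly {F : ℕ → NBV} (hF : CauchySeq F) :
    ∃ G, TendstoUniformly (fun n => (F n).toFun) G atTop := by
  have hunif : UniformCauchySeqOn (fun n => (F n).toFun) atTop univ :=
    Metric.uniformCauchySeqOn_iff.2 fun ε hε => by
      obtain ⟨N, hN⟩ := Metric.cauchySeq_iff.1 hF ε hε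
      refine ⟨N, fun m hm n hn x _ => lt_of_le_of_lt ?_ (hN m hm n hn)⟩
      rw [Real.dist_eq, dist_eq_norm]
      exact (F m - F n).abs_le_norm x
  choose G hG using fun x => cauchySeq_tendsto_of_complete (hunif.cauchySeq (mem_univ x))
  exact ⟨G, tendstoUniformlyOn_univ.1 (hunif.tendstoUniformlyOn_of_tendsto fun x _ => hG x)⟩

lemma tendsto_of_cauchySeq {F : ℕ → NBV} (hF : CauchySeq F) {G : NBV}
    (hG : ∀ x, Tendsto (fun n => (F n).toFun x) atTop (𝓝 (G.toFun x))) :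
    Tendsto F atTop (𝓝 G) := by
  refine Metric.tendsto_atTop'.2 fun ε hε => ?_
  obtain ⟨N, hN⟩ := Metric.cauchySeq_iff.1 hF (ε / 2) (half_pos hε)
  refine ⟨N, fun n hn => lt_of_le_of_lt ?_ (half_lt_self hε)⟩
  rw [dist_eq_norm, ← variation_le_ofReal_iff (half_pos hε).le]
  refine eVariationOn_le_of_tendsto (p := atTop) (F := fun m => (F n - F m).toFun)
    (fun x _ => tendsto_const_nhds.sub (hG x)) ?_
  filter_upwards [eventually_ge_atTop N] with m hm
  exact (variation_le_ofReal_iff (half_pos hε).le).2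
    ((dist_eq_norm (F n) (F m)).symm.trans_le (hN n hn.le m hm).le)

instance : CompleteSpace NBV := by
  refine Metric.complete_of_cauchySeq_tendsto fun F hF => ?_
  obtain ⟨G, hG⟩ := exists_tendstoUniformly hF
  obtain ⟨C, hC⟩ := hF.isBounded_range.exists_norm_le
  have hvar (n : ℕ) : variation (F n).toFun ≤ ENNReal.ofReal C := by
    have hn := hC _ (mem_range_self n)
    exact (variation_le_ofReal_iff ((norm_nonneg _).trans hn)).2 hn
  have hmem : G ∈ nbv := mem_nbv_of_tendstoUniformly (fun n => (F n).mem) ENNReal.ofReal_lt_top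
    (Eventually.of_forall hvar) hG
  exact ⟨mk G hmem, tendsto_of_cauchySeq hF hG.tendsto_at⟩

end NBV

/-! ### The Poisson integral is linear and isometric -/

section PoissonIsometry

variable {f g : ℝ → ℝ}

lemma tendsto_comp_add_nhdsGT {l : Filter ℝ} {x : ℝ} (h : Tendsto g (𝓝[>] x) l) :
    Tendsto (fun ε => g (x + ε)) (𝓝[>] 0) l := by
  refine h.comp ?_
  rw [Tendsto, map_add_left_nhdsGT, add_zero]

lemma neBot_nhdsWithin_Ioi_diff_countable {s : Set ℝ} (hs : s.Countable) (x : ℝ) :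
    (𝓝[Ioi x \ s] x).NeBot := by
  have hsub : closure (Ioi x) ⊆ closure (Ioi x ∩ sᶜ) :=
    closure_minimal ((hs.dense_compl ℝ).open_subset_closure_inter isOpen_Ioi) isClosed_closure
  rw [← mem_closure_iff_nhdsWithin_neBot, sdiff_eq]
  exact hsub (closure_Ioi x ▸ self_mem_Ici)

/- Shifting a partition slightly to the right makes all of its nodes points of continuity of `g`,
where the Poisson integral converges; right continuity lets the shift tend to zero. -/
lemma variation_le_of_forall_variation_slice_le (hg : IsBV g)
    (hright : ∀ x, ContinuousWithinAt g (Ici x) x) {C : ℝ≥0∞}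
    (hC : ∀ r ∈ Ico (0 : ℝ) 1, variation (slice (poissonIntegral g) r) ≤ C) :
    variation g ≤ C := by
  refine iSup_le fun ⟨n, u, hu, hus⟩ => ?_
  have hrange : range u ⊆ Icc (-Real.pi) Real.pi := range_subset_iff.2 hus
  set N : Set ℝ := ⋃ k, (u k + ·) ⁻¹' {x | ¬ContinuousAt g x}
  have hN : N.Countable := countable_iUnion fun k =>
    hg.countable_not_continuousAt.preimage (add_right_injective (u k))
  have hshift {ε : ℝ} (hε : ε ∉ N) : eVariationOn (fun x => g (x + ε)) (range u) ≤ C := by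
    have hcont : ∀ x ∈ range u, ContinuousAt g (x + ε) := by
      rintro _ ⟨k, rfl⟩
      by_contra h
      exact hε (mem_iUnion.2 ⟨k, h⟩)
    refine eVariationOn_le_of_tendsto (p := 𝓝[<] (1 : ℝ)) (fun x hx =>
      tendsto_slice_poissonIntegral hg.1 (hg.intervalIntegrable _ _) (hcont x hx)) ?_
    filter_upwards [eventually_mem_Ico_zero_one] with r hr
    refine ((eVariationOn.mono _ hrange).trans_eq ?_).trans (hC r hr)
    exact variation_comp_add_const (periodic_slice _ r) ε
  have := neBot_nhdsWithin_Ioi_diff_countable hN 0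
  have hlim (x : ℝ) : Tendsto (fun ε => g (x + ε)) (𝓝[Ioi 0 \ N] 0) (𝓝 (g x)) :=
    (tendsto_comp_add_nhdsGT ((hright x).mono Ioi_subset_Ici_self)).mono_left
      (nhdsWithin_mono _ sdiff_subset)
  exact (eVariationOn.sum_le hu (s := range u) mem_range_self).trans <|
    eVariationOn_le_of_tendsto (fun x _ => hlim x) <|
      eventually_nhdsWithin_of_forall fun ε hε => hshift hε.2

lemma hardyVariation_poissonIntegral_le (hg : IsBV g) :
    hardyVariation (poissonIntegral g) ≤ variation g :=
  iSup₂_le fun _ hr => variation_slice_poissonIntegral_le hg.1 (hg.intervalIntegrable _ _) hr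

lemma hardyVariation_poissonIntegral (hg : g ∈ nbv) :
    hardyVariation (poissonIntegral g) = variation g :=
  le_antisymm (hardyVariation_poissonIntegral_le hg.1) <|
    variation_le_of_forall_variation_slice_le hg.1 hg.2.2 fun _ hr =>
      variation_slice_le_hardyVariation _ hr

lemma poissonIntegral_mem_hbv (hg : IsBV g) : poissonIntegral g ∈ hbv :=
  ⟨isHarmonicOnDisc_poissonIntegral hg.1 (hg.intervalIntegrable _ _),
    (hardyVariation_poissonIntegral_le hg).trans_lt hg.2⟩

lemma continuous_polarPoissonKernel_sub_arg (z : Disc) :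
    Continuous fun φ => polarPoissonKernel ‖(z : ℂ)‖ (φ - Complex.arg z) :=
  (continuous_polarPoissonKernel (norm_mem_Ico z)).comp (continuous_sub_right _)

lemma poissonIntegral_add (hf : IntervalIntegrable f volume (-Real.pi) Real.pi)
    (hg : IntervalIntegrable g volume (-Real.pi) Real.pi) :
    poissonIntegral (f + g) = poissonIntegral f + poissonIntegral g := by
  funext z
  have hK := (continuous_polarPoissonKernel_sub_arg z).continuousOn (s := uIcc (-Real.pi) Real.pi)
  simp only [poissonIntegral, Pi.add_apply, add_mul]
  exact intervalIntegral.integral_add (hf.mul_continuousOn hK) (hg.mul_continuousOn hK)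

lemma poissonIntegral_smul (c : ℝ) (g : ℝ → ℝ) :
    poissonIntegral (c • g) = c • poissonIntegral g := by
  funext z
  simp only [poissonIntegral, Pi.smul_apply, smul_eq_mul, mul_assoc,
    intervalIntegral.integral_const_mul]

lemma poissonIntegral_const (c : ℝ) (z : Disc) : poissonIntegral (fun _ => c) z = c := by
  rw [← slice_norm_arg (poissonIntegral _), slice_poissonIntegral (fun _ => rfl) (norm_mem_Ico z),
    intervalIntegral.integral_const_mul, integral_polarPoissonKernel (norm_mem_Ico z), mul_one]

/-! ### The right continuous modification -/

lemma isBV_const (c : ℝ) : IsBV fun _ => c :=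
  ⟨fun _ => rfl, (variation_const c).trans_lt ENNReal.zero_lt_top⟩

lemma IsBV.tendsto_rightLim (hg : IsBV g) (x : ℝ) :
    Tendsto g (𝓝[>] x) (𝓝 (g.rightLim x)) := by
  obtain ⟨p, q, hp, hq, rfl⟩ :=
    hg.locallyBoundedVariationOn.exists_monotoneOn_sub_monotoneOn
  rw [monotoneOn_univ] at hp hq
  exact tendsto_rightLim_of_tendsto ⟨_, (hp.tendsto_rightLim x).sub (hq.tendsto_rightLim x)⟩

lemma IsBV.rightLim (hg : IsBV g) : IsBV g.rightLim := by
  have hlim (x : ℝ) := tendsto_comp_add_nhdsGT (hg.tendsto_rightLim x)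
  refine ⟨fun x => ?_, lt_of_le_of_lt ?_ hg.2⟩
  · refine tendsto_nhds_unique (hlim _) ((hlim x).congr fun ε => ?_)
    rw [add_right_comm, hg.1]
  · exact eVariationOn_le_of_tendsto (fun x _ => hlim x)
      (Eventually.of_forall fun ε => (variation_comp_add_const hg.1 ε).le)

lemma IsBV.poissonIntegral_rightLim (hg : IsBV g) :
    poissonIntegral g.rightLim = poissonIntegral g := by
  funext z
  refine intervalIntegral.integral_congr_ae ?_
  filter_upwards [hg.countable_not_continuousAt.ae_notMem volume] with x hx _
  rw [(not_not.1 hx).continuousWithinAt.rightLim_eq]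

lemma IsBV.exists_nbv_poissonIntegral_eq (hg : IsBV g) :
    ∃ σ ∈ nbv, ∃ c : ℝ, ∀ z, poissonIntegral g z = poissonIntegral σ z + c := by
  set c := g.rightLim (-Real.pi) with hc
  set σ : ℝ → ℝ := g.rightLim + fun _ => -c with hσ
  have hσ_bv : IsBV σ := ⟨hg.rightLim.1.add fun _ => rfl, (variation_add_le _ _).trans_lt
    (ENNReal.add_lt_top.2 ⟨hg.rightLim.2, (isBV_const (-c)).2⟩)⟩
  refine ⟨σ, ⟨hσ_bv, by simp [hσ, hc], fun x => ?_⟩, c, fun z => ?_⟩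
  · exact (continuousWithinAt_rightLim_Ici (hg.tendsto_rightLim x)).add continuousWithinAt_const
  · rw [poissonIntegral_add (hg.rightLim.intervalIntegrable _ _)
      ((isBV_const _).intervalIntegrable _ _), Pi.add_apply, poissonIntegral_const,
      hg.poissonIntegral_rightLim, neg_add_cancel_right]

end PoissonIsometry

/-! ### Pointwise compactness of sets of functions of bounded variation -/

lemma isClosed_setOf_eVariationOn_le {α E : Type*} [LinearOrder α] [PseudoEMetricSpace E]
    (s : Set α) (C : ℝ≥0∞) : IsClosed {h : α → E | eVariationOn h s ≤ C} := by
  refine isClosed_of_closure_subset fun g hg => ?_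
  have := mem_closure_iff_nhdsWithin_neBot.1 hg
  have hlim : Tendsto id (𝓝[{h : α → E | eVariationOn h s ≤ C}] g) (𝓝 g) :=
    tendsto_id.mono_left nhdsWithin_le_nhds
  exact eVariationOn_le_of_tendsto (fun x _ => tendsto_pi_nhds.1 hlim x) self_mem_nhdsWithin

lemma isClosed_setOf_periodic {α E : Type*} [Add α] [TopologicalSpace E] [T2Space E] (T : α) :
    IsClosed {h : α → E | Function.Periodic h T} := by
  simp only [Function.Periodic, ofPred_forall]
  exact isClosed_iInter fun x => isClosed_eq (continuous_apply _) (continuous_apply _)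

lemma isCompact_setOf_periodic_eVariationOn_le {α E : Type*} [LinearOrder α] [Add α]
    [EMetricSpace E] {B : Set E} (hB : IsCompact B) (T : α) (s : Set α) (C : ℝ≥0∞) :
    IsCompact {h : α → E | (∀ x, h x ∈ B) ∧ Function.Periodic h T ∧ eVariationOn h s ≤ C} := by
  have hpi : IsCompact {h : α → E | ∀ x, h x ∈ B} := isCompact_pi_infinite fun _ => hB
  exact hpi.inter_right ((isClosed_setOf_periodic T).inter (isClosed_setOf_eVariationOn_le s C))

section StepSum

variable {h K : ℝ → ℝ} {a b : ℝ}

lemma intervalIntegrable_mul_of_boundedVariationOn (hab : a ≤ b)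
    (hh : BoundedVariationOn h (Icc a b)) (hK : ContinuousOn K (Icc a b)) :
    IntervalIntegrable (fun x => h x * K x) volume a b := by
  rw [← uIcc_of_le hab] at hh hK
  exact (intervalIntegrable_of_boundedVariationOn hh).mul_continuousOn hK

lemma abs_integral_mul_sub_mul_integral_le (hab : a ≤ b) (hh : BoundedVariationOn h (Icc a b))
    (hK : ContinuousOn K (Icc a b)) {C : ℝ} (hC : ∀ x ∈ Icc a b, |K x| ≤ C) :
    |(∫ x in a..b, h x * K x) - h a * ∫ x in a..b, K x|
      ≤ (eVariationOn h (Icc a b)).toReal * C * (b - a) := by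
  rw [← intervalIntegral.integral_const_mul, ← intervalIntegral.integral_sub
      (intervalIntegrable_mul_of_boundedVariationOn hab hh hK)
      ((hK.intervalIntegrable_of_Icc hab).const_mul _),
    ← Real.norm_eq_abs, ← abs_of_nonneg (sub_nonneg.2 hab)]
  refine intervalIntegral.norm_integral_le_of_norm_le_const fun x hx => ?_
  rw [uIoc_of_le hab] at hx
  have hxI := Ioc_subset_Icc_self hx
  rw [← sub_mul, norm_mul, ← dist_eq_norm]
  exact mul_le_mul (hh.dist_le hxI (left_mem_Icc.2 hab)) (hC x hxI) (norm_nonneg _)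
    ENNReal.toReal_nonneg

/-- The `k`-th node `a + k (b - a) / n` of the partition of `[a, b]` into `n` equal parts. -/
def node (a b : ℝ) (n k : ℕ) : ℝ := a + k * ((b - a) / n)

lemma monotone_node (hab : a ≤ b) (n : ℕ) : Monotone (node a b n) := fun i j hij => by
  have : 0 ≤ b - a := sub_nonneg.2 hab
  unfold node
  gcongr

lemma node_zero (a b : ℝ) (n : ℕ) : node a b n 0 = a := by simp [node]

lemma node_self (a b : ℝ) {n : ℕ} (hn : n ≠ 0) : node a b n n = b := by
  have : (n : ℝ) ≠ 0 := Nat.cast_ne_zero.2 hn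
  rw [node]
  field_simp
  ring

lemma node_succ_sub (a b : ℝ) (n k : ℕ) : node a b n (k + 1) - node a b n k = (b - a) / n := by
  simp only [node, Nat.cast_succ]
  ring

/-- The integral of `h K` over `[a, b]`, with `h` replaced on each of `n` equal parts of `[a, b]` by
its value at the left endpoint. -/
def stepSum (K : ℝ → ℝ) (a b : ℝ) (n : ℕ) (h : ℝ → ℝ) : ℝ :=
  ∑ k ∈ Finset.range n, h (node a b n k) * ∫ x in node a b n k..node a b n (k + 1), K x

lemma continuous_stepSum (K : ℝ → ℝ) (a b : ℝ) (n : ℕ) : Continuous (stepSum K a b n) :=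
  continuous_finsetSum _ fun _ _ => (continuous_apply _).mul_const _

lemma abs_integral_mul_sub_stepSum_le (hab : a ≤ b) (hh : BoundedVariationOn h (Icc a b))
    (hK : ContinuousOn K (Icc a b)) {C : ℝ} (hC : ∀ x ∈ Icc a b, |K x| ≤ C) {n : ℕ} (hn : n ≠ 0) :
    |(∫ x in a..b, h x * K x) - stepSum K a b n h|
      ≤ (eVariationOn h (Icc a b)).toReal * C * ((b - a) / n) := by
  set x := node a b n
  have hmono : Monotone x := monotone_node hab n
  have h0 : x 0 = a := node_zero a b n
  have hlast : x n = b := node_self a b hn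
  have hsub {k : ℕ} (hk : k < n) : Icc (x k) (x (k + 1)) ⊆ Icc a b :=
    Icc_subset_Icc (h0 ▸ hmono k.zero_le) (hlast ▸ hmono hk)
  have hsum : ∑ k ∈ Finset.range n, ∫ y in x k..x (k + 1), h y * K y = ∫ y in a..b, h y * K y := by
    rw [intervalIntegral.sum_integral_adjacent_intervals fun k hk =>
      intervalIntegrable_mul_of_boundedVariationOn (hmono k.le_succ) (hh.mono (hsub hk))
        (hK.mono (hsub hk)), h0, hlast]
  have hvar : ∑ k ∈ Finset.range n, (eVariationOn h (Icc (x k) (x (k + 1)))).toReal =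
      (eVariationOn h (Icc a b)).toReal := by
    rw [← ENNReal.toReal_sum fun k hk => hh.mono (hsub (Finset.mem_range.1 hk)),
      eVariationOn.sum' h hmono, h0, hlast]
  rw [← hsum, stepSum, ← Finset.sum_sub_distrib, ← hvar, Finset.sum_mul, Finset.sum_mul]
  refine (Finset.abs_sum_le_sum_abs _ _).trans (Finset.sum_le_sum fun k hk => ?_)
  have hk := hsub (Finset.mem_range.1 hk)
  rw [← node_succ_sub a b n k]
  exact abs_integral_mul_sub_mul_integral_le (hmono k.le_succ) (hh.mono hk) (hK.mono hk)
    fun y hy => hC y (hk hy)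

lemma tendstoUniformlyOn_stepSum (hab : a ≤ b) (hK : ContinuousOn K (Icc a b)) {V : ℝ≥0∞}
    (hV : V < ∞) :
    TendstoUniformlyOn (stepSum K a b) (fun h => ∫ x in a..b, h x * K x) atTop
      {h | eVariationOn h (Icc a b) ≤ V} := by
  obtain ⟨C, hC⟩ := isCompact_Icc.exists_bound_of_continuousOn hK
  have hlim : Tendsto (fun n : ℕ => V.toReal * C * ((b - a) / n)) atTop (𝓝 0) := by
    simpa using (tendsto_const_div_atTop_nhds_zero_nat (b - a)).const_mul (V.toReal * C)
  rw [Metric.tendstoUniformlyOn_iff]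
  intro ε hε
  filter_upwards [hlim.eventually_lt_const hε, eventually_ne_atTop 0] with n hn hn0 h hh
  refine lt_of_le_of_lt ?_ hn
  refine (abs_integral_mul_sub_stepSum_le hab (hh.trans_lt hV).ne hK hC hn0).trans ?_
  have hC0 : 0 ≤ C := (norm_nonneg _).trans (hC a (left_mem_Icc.2 hab))
  have : 0 ≤ b - a := sub_nonneg.2 hab
  have hVtop := hV.ne
  gcongr

lemma continuousOn_integral_mul (hab : a ≤ b) (hK : ContinuousOn K (Icc a b)) {V : ℝ≥0∞}
    (hV : V < ∞) : ContinuousOn (fun h : ℝ → ℝ => ∫ x in a..b, h x * K x)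
      {h | eVariationOn h (Icc a b) ≤ V} :=
  (tendstoUniformlyOn_stepSum hab hK hV).continuousOn
    (Frequently.of_forall fun n => (continuous_stepSum K a b n).continuousOn)

end StepSum

/-! ### Every function of `h^BV` is a Poisson integral -/

lemma continuousOn_poissonIntegral (z : Disc) {V : ℝ≥0∞} (hV : V < ∞) :
    ContinuousOn (fun h => poissonIntegral h z) {h | variation h ≤ V} :=
  continuousOn_integral_mul (by linarith [Real.pi_pos])
    (continuous_polarPoissonKernel_sub_arg z).continuousOn hV

lemma IsHarmonicOnDisc.tendsto_poissonIntegral_slice {u : Disc → ℝ} (hu : IsHarmonicOnDisc u)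
    (z : Disc) : Tendsto (fun r => poissonIntegral (slice u r) z) (𝓝[<] 1) (𝓝 (u z)) := by
  have hcont : ContinuousAt (extendZero u) z := (hu _ z.2).1.continuousAt
  have hz : extendZero u z = u z := dif_pos z.2
  have hradial : Tendsto (fun r : ℝ => (r : ℂ) * z) (𝓝 1) (𝓝 z) :=
    Continuous.tendsto' (by fun_prop) _ _ (by simp)
  rw [← hz]
  refine ((hcont.tendsto.comp hradial).mono_left nhdsWithin_le_nhds).congr' ?_
  filter_upwards [Ioo_mem_nhdsLT (zero_lt_one' ℝ)] with r hr
  exact hu.extendZero_mul_eq_poissonIntegral hr z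

lemma exists_isBV_mapClusterPt_slice {u : Disc → ℝ} (hu : u ∈ hbv) :
    ∃ g, IsBV g ∧ variation g ≤ hardyVariation u ∧ MapClusterPt g (𝓝[<] 1) (slice u) := by
  obtain ⟨g, hg, hcluster⟩ := (isCompact_setOf_periodic_eVariationOn_le
      (isCompact_closedBall (extendZero u 0) (hardyVariation u).toReal) (2 * Real.pi)
      (Icc (-Real.pi) Real.pi) (hardyVariation u)).exists_mapClusterPt
    (f := 𝓝[<] 1) (u := slice u) <| tendsto_principal.2 <| by
      filter_upwards [eventually_mem_Ico_zero_one] with r hr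
      refine ⟨fun θ => ?_, periodic_slice u r, variation_slice_le_hardyVariation u hr⟩
      rw [Metric.mem_closedBall, dist_edist]
      exact ENNReal.toReal_mono hu.2.ne (hu.1.edist_slice_extendZero_zero_le hr θ)
  exact ⟨g, ⟨hg.2.1, hg.2.2.trans_lt hu.2⟩, hg.2.2, hcluster⟩

lemma exists_isBV_eq_poissonIntegral {u : Disc → ℝ} (hu : u ∈ hbv) :
    ∃ g, IsBV g ∧ ∀ z, u z = poissonIntegral g z := by
  obtain ⟨g, hg, hgV, hcluster⟩ := exists_isBV_mapClusterPt_slice hu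
  obtain ⟨l, hl, hlim⟩ := mapClusterPt_iff_ultrafilter.1 hcluster
  refine ⟨g, hg, fun z => ?_⟩
  have hwithin : Tendsto (slice u) l (𝓝[{h | variation h ≤ hardyVariation u}] g) :=
    tendsto_nhdsWithin_iff.2 ⟨hlim, hl <| by
      filter_upwards [eventually_mem_Ico_zero_one] with r hr
      exact variation_slice_le_hardyVariation u hr⟩
  exact tendsto_nhds_unique ((hu.1.tendsto_poissonIntegral_slice z).mono_left hl)
    ((continuousOn_poissonIntegral z hu.2 g hgV).tendsto.comp hwithin)

/-! ### The isometric isomorphism -/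

/-- The linear map `g ↦ P[g]` from `NBV` to the functions of `h^BV`. -/
def poissonHBV : NBV →ₗ[ℝ] HBV where
  toFun g := (⟨poissonIntegral g.toFun, poissonIntegral_mem_hbv g.mem.1⟩ : hbv)
  map_add' f g := Subtype.ext (poissonIntegral_add (f.mem.1.intervalIntegrable _ _)
    (g.mem.1.intervalIntegrable _ _))
  map_smul' c g := Subtype.ext (poissonIntegral_smul c g.toFun)

lemma toFun_poissonHBV (g : NBV) : (poissonHBV g).toFun = poissonIntegral g.toFun := rfl

lemma norm_poissonHBV (g : NBV) : ‖poissonHBV g‖ = ‖g‖ := by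
  rw [HBV.norm_def, NBV.norm_def, toFun_poissonHBV, hardyVariation_poissonIntegral g.mem]

/-- The linear isometry `g ↦ P[g]` from `NBV` into `h^BV` modulo constants. -/
def poissonIsometry : NBV →ₗᵢ[ℝ] SeparationQuotient HBV where
  toLinearMap := (SeparationQuotient.mkCLM ℝ HBV).toLinearMap.comp poissonHBV
  norm_map' g := (SeparationQuotient.norm_mk (poissonHBV g)).trans (norm_poissonHBV g)

lemma HBV.mk_eq_mk_iff {u v : HBV} : (SeparationQuotient.mk u : SeparationQuotient HBV) =
    SeparationQuotient.mk v ↔ ∃ c : ℝ, ∀ z, u.toFun z = v.toFun z + c := by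
  rw [SeparationQuotient.mk_eq_mk, Metric.inseparable_iff, dist_eq_norm, HBV.norm_eq_zero_iff]
  exact exists_congr fun c => forall_congr' fun z => sub_eq_iff_eq_add'

lemma poissonIsometry_surjective : Function.Surjective poissonIsometry := by
  intro x
  obtain ⟨u, rfl⟩ := SeparationQuotient.surjective_mk x
  obtain ⟨g, hg, hug⟩ := exists_isBV_eq_poissonIntegral u.2
  obtain ⟨σ, hσ, c, hc⟩ := hg.exists_nbv_poissonIntegral_eq
  refine ⟨NBV.mk σ hσ, (HBV.mk_eq_mk_iff.2 ⟨c, fun z => ?_⟩).symm⟩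
  exact (hug z).trans (hc z)

/-- The linear isometric isomorphism `g ↦ P[g]` from `NBV` onto `h^BV` modulo constants. -/
def poissonEquiv : NBV ≃ₗᵢ[ℝ] SeparationQuotient HBV :=
  LinearIsometryEquiv.ofSurjective poissonIsometry poissonIsometry_surjective

lemma poissonEquiv_apply (g : NBV) :
    poissonEquiv g = SeparationQuotient.mk (poissonHBV g) := rfl

instance : CompleteSpace (SeparationQuotient HBV) :=
  poissonEquiv.symm.toIsometryEquiv.completeSpace

end PoissonBV

end

theorem mainTheorem8 :
    -- (a) weak* convergence in `NBV`: convergence of the pairing with every `f` in `HK`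
    (∀ g ∈ PoissonBV.nbv, ∀ f : ℝ → ℝ, PoissonBV.IsHK f →
      PoissonBV.HKIntegrable (fun θ => f θ * g θ) ∧
      (∀ r ∈ Ico (0 : ℝ) 1, PoissonBV.HKIntegrable
        (fun θ => f θ * PoissonBV.slice (PoissonBV.poissonIntegral g) r θ)) ∧
      Tendsto (fun r => PoissonBV.hkIntegral
          (fun θ => f θ * PoissonBV.slice (PoissonBV.poissonIntegral g) r θ))
        (𝓝[<] 1) (𝓝 (PoissonBV.hkIntegral (fun θ => f θ * g θ)))) ∧
    -- (b)
    (∀ g : ℝ → ℝ, PoissonBV.IsBV g → ∀ r ∈ Ico (0 : ℝ) 1,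
      (⨆ θ : ℝ, ‖PoissonBV.slice (PoissonBV.poissonIntegral g) r θ‖ₑ)
        ≤ (⨅ θ : ℝ, ‖g θ‖ₑ) + PoissonBV.variation g) ∧
    -- (c)
    (∀ g ∈ PoissonBV.nbv, ∀ r ∈ Ico (0 : ℝ) 1,
      (⨆ θ : ℝ, ‖PoissonBV.slice (PoissonBV.poissonIntegral g) r θ‖ₑ)
        ≤ PoissonBV.variation g) ∧
    -- (d)
    (∀ g : ℝ → ℝ, PoissonBV.IsBV g → ∀ r ∈ Ico (0 : ℝ) 1,
      PoissonBV.variation (PoissonBV.slice (PoissonBV.poissonIntegral g) r)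
        ≤ PoissonBV.variation g) ∧
    -- (e) convergence in variation can fail, in `NBV` ...
    (∃ σ ∈ PoissonBV.nbv,
      ¬ Tendsto (fun r => PoissonBV.variation
          (PoissonBV.slice (PoissonBV.poissonIntegral σ) r - σ)) (𝓝[<] 1) (𝓝 0)) ∧
    -- ... and for a function that is everywhere the mean of its one-sided limits
    (∃ τ : ℝ → ℝ, PoissonBV.IsBV τ ∧
      (∀ θ : ℝ, ∃ l₁ l₂ : ℝ, Tendsto τ (𝓝[>] θ) (𝓝 l₁) ∧ Tendsto τ (𝓝[<] θ) (𝓝 l₂) ∧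
        τ θ = (l₁ + l₂) / 2) ∧
      ¬ Tendsto (fun r => PoissonBV.variation
          (PoissonBV.slice (PoissonBV.poissonIntegral τ) r - τ)) (𝓝[<] 1) (𝓝 0)) ∧
    -- (f) the null space of the seminorm of `h^BV` consists of the constants; modulo these,
    -- `g ↦ P[g]` is an isometric isomorphism of the Banach spaces `NBV` and `h^BV`
    (∀ u : PoissonBV.HBV, ‖u‖ = 0 ↔ ∃ c : ℝ, ∀ z : PoissonBV.Disc, u.toFun z = c) ∧
    CompleteSpace PoissonBV.NBV ∧
    CompleteSpace (SeparationQuotient PoissonBV.HBV) ∧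
    (∃ T : PoissonBV.NBV ≃ₗᵢ[ℝ] SeparationQuotient PoissonBV.HBV,
      ∀ g : PoissonBV.NBV, ∃ u : PoissonBV.HBV,
        u.toFun = PoissonBV.poissonIntegral g.toFun ∧ T g = SeparationQuotient.mk u) := by
  refine ⟨fun g hg f hf => ⟨?_, fun r hr => ?_, ?_⟩, fun g hg r hr => ?_, fun g hg r hr => ?_,
    fun g hg r hr => ?_, ?_, ?_, ?_, inferInstance, inferInstance, ?_⟩
  · exact PoissonBV.HKIntegrableOn.mul (I := PoissonBV.periodBox) hf.2 hg.1.2.ne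
  · exact PoissonBV.HKIntegrableOn.mul (I := PoissonBV.periodBox) hf.2
      (PoissonBV.isBV_slice_poissonIntegral hg.1 hr).2.ne
  · exact PoissonBV.tendsto_hkIntegral_mul_slice_poissonIntegral hf.2 hg.1
  · exact PoissonBV.iSup_enorm_slice_poissonIntegral_le hg hr
  · exact PoissonBV.iSup_enorm_slice_poissonIntegral_le_variation hg hr
  · exact PoissonBV.variation_slice_poissonIntegral_le hg.1 (hg.intervalIntegrable _ _) hr
  · exact PoissonBV.exists_nbv_not_tendsto_variation
  · exact PoissonBV.exists_mean_not_tendsto_variation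
  · exact PoissonBV.HBV.norm_eq_zero_iff
  · exact ⟨PoissonBV.poissonEquiv, fun g => ⟨PoissonBV.poissonHBV g, PoissonBV.toFun_poissonHBV g,
      PoissonBV.poissonEquiv_apply g⟩⟩
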